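/- Let $p,\alpha_0,\alpha_1,\theta$ be real numbers with $p>1$, $\alpha_1-p+1>0$, $\alpha_0\ge\alpha_1-p$ and $\theta>\alpha_1-p$, and set $p^*=\frac{(\theta+1)p}{\alpha_1-p+1}$. For $a\in\mathbb R$ let $L^p_a=L^p((0,1),r^a\,dr)$. Let $X=X^{1,p}_1(\alpha_0,\alpha_1)$ be the closure of the set of all $u\in AC_{loc}(0,1)$ with $\lim_{r\to1}u(r)=0$, $u\in L^p_{\alpha_0}$ and $u'\in L^p_{\alpha_1}$, with respect to the norm $(\|u\|_{L^p_{\alpha_0}}^p+\|u'\|_{L^p_{\alpha_1}}^p)^{1/p}$, and write $\|u\|=\|u'\|_{L^p_{\alpha_1}}$ for $u\in X$. For $\tau>0$ and $\beta>0$ define, with suprema taken in $[0,\infty]$, $$\Sigma_p=\sup\Big\{\int_0^1 r^\theta|u|^{p^*}\,dr : u\in X,\ \|u\|=1\Big\},\qquad \mathcal F_{\tau,\beta,\theta}=\sup\Big\{\int_0^1 r^\theta|u|^{p^*}\,\big|\ln(\tau+|u|)\big|^{r^\beta}\,dr : u\in X,\ \|u\|=1\Big\}.$$ Then for every $\tau>0$: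 (i) $\mathcal F_{\tau,\beta,\theta}\ge\Sigma_p$ for every $\beta>0$; (ii) $\mathcal F_{\tau,\beta,\theta}>\Sigma_p$ if $0<\beta<\min\big\{\frac{\theta+1}{p},\frac{\alpha_1-p+1}{p-1}\big\}$; (iii) $\lim_{\beta\to\infty}\mathcal F_{\tau,\beta,\theta}=\Sigma_p$. -/

import Mathlib

open MeasureTheory Set Filter Topology
open scoped ENNReal

noncomputable section

namespace LogHardySobolev

/-- The measure `r ^ a dr` on the interval `(0, 1)`. -/
def weight (a : ℝ) : Measure ℝ :=
  (volume.restrict (Ioo 0 1)).withDensity fun r => ENNReal.ofReal (r ^ a)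

/-- The norm of the weighted Lebesgue space `L^p_a = L^p((0, 1), r ^ a dr)`. -/
def wNorm (p a : ℝ) (f : ℝ → ℝ) : ℝ≥0∞ :=
  eLpNorm f (ENNReal.ofReal p) (weight a)

/-- Membership in the weighted Lebesgue space `L^p_a = L^p((0, 1), r ^ a dr)`. -/
def MemLpW (p a : ℝ) (f : ℝ → ℝ) : Prop :=
  MemLp f (ENNReal.ofReal p) (weight a)

/-- `u` is locally absolutely continuous on the open interval `(0, 1)`. -/
def LocallyAC (u : ℝ → ℝ) : Prop :=
  ∀ a b : ℝ, 0 < a → a ≤ b → b < 1 → AbsolutelyContinuousOnInterval u a b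

/-- The functions `u ∈ AC_loc(0, 1)` with `u(r) → 0` as `r → 1`, `u ∈ L^p_{α₀}` and
`u' ∈ L^p_{α₁}`. (A function in `AC_loc(0, 1)` is differentiable almost everywhere on
`(0, 1)`, and `deriv u` is its a.e. derivative.) -/
def PreX (p α₀ α₁ : ℝ) (u : ℝ → ℝ) : Prop :=
  LocallyAC u ∧ Tendsto u (𝓝[<] 1) (𝓝 0) ∧
    MemLpW p α₀ u ∧ MemLpW p α₁ (deriv u)

/-- The full norm `(‖u‖_{L^p_{α₀}} ^ p + ‖v‖_{L^p_{α₁}} ^ p) ^ (1 / p)` of a function `u`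
with derivative `v`. -/
def xNorm (p α₀ α₁ : ℝ) (u v : ℝ → ℝ) : ℝ≥0∞ :=
  (wNorm p α₀ u ^ p + wNorm p α₁ v ^ p) ^ (1 / p)

/-- `MemX p α₀ α₁ u v`: the function `u` belongs to `X^{1,p}_1(α₀, α₁)`, the closure of
`PreX p α₀ α₁` in the full norm, and `v` is its derivative. In other words, the pair `(u, v)`
lies in the closure in `L^p_{α₀} × L^p_{α₁}` of the set of pairs `(w, w')`, `w ∈ PreX`. -/
def MemX (p α₀ α₁ : ℝ) (u v : ℝ → ℝ) : Prop :=
  MemLpW p α₀ u ∧ MemLpW p α₁ v ∧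
    ∀ ε : ℝ≥0∞, 0 < ε → ∃ w : ℝ → ℝ, PreX p α₀ α₁ w ∧
      xNorm p α₀ α₁ (fun r => u r - w r) (fun r => v r - deriv w r) < ε

/-- The critical exponent `p* = (θ + 1) p / (α₁ - p + 1)`. -/
def critExp (p α₁ θ : ℝ) : ℝ := (θ + 1) * p / (α₁ - p + 1)

/-- The supremum, in `[0, ∞]`, of `∫₀¹ r^θ |u|^{p*} |ln(τ + |u|)|^{φ(r)} dr` over all
`u ∈ X^{1,p}_1(α₀, α₁)` with gradient norm `‖u'‖_{L^p_{α₁}} = 1`. -/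
def supS (p α₀ α₁ θ τ : ℝ) (φ : ℝ → ℝ) : ℝ≥0∞ :=
  ⨆ (u : ℝ → ℝ) (v : ℝ → ℝ) (_ : MemX p α₀ α₁ u v) (_ : wNorm p α₁ v = 1),
    ∫⁻ r in Ioo (0 : ℝ) 1,
      ENNReal.ofReal (r ^ θ * |u r| ^ critExp p α₁ θ * |Real.log (τ + |u r|)| ^ φ r)

/-- The supremum `𝓕_{τ,β,θ}`, that is, the case `φ(r) = r ^ β`. -/
def supF (p α₀ α₁ θ τ β : ℝ) : ℝ≥0∞ :=
  supS p α₀ α₁ θ τ fun r => r ^ β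

/-- The best Sobolev constant `Σ_p`: the supremum, in `[0, ∞]`, of `∫₀¹ r^θ |u|^{p*} dr` over
all `u ∈ X^{1,p}_1(α₀, α₁)` with gradient norm `‖u'‖_{L^p_{α₁}} = 1`. -/
def sobolevSup (p α₀ α₁ θ : ℝ) : ℝ≥0∞ :=
  ⨆ (u : ℝ → ℝ) (v : ℝ → ℝ) (_ : MemX p α₀ α₁ u v) (_ : wNorm p α₁ v = 1),
    ∫⁻ r in Ioo (0 : ℝ) 1, ENNReal.ofReal (r ^ θ * |u r| ^ critExp p α₁ θ)

end LogHardySobolev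

end

namespace LogHardySobolev

/-! Put a = α₁ - p + 1, d = θ + 1 and q = p* = dp/a, so that 0 < a < d. Everything is compared with
the sharp constant C = `blissConst p a d` of Bliss' inequality ∫₀¹ r^(d-1) (∫_r^1 |v|)^q dr ≤ C
‖v‖^q.

Upper bound: an element of X satisfies |u(r)| ≤ ∫_r^1 |u'| almost everywhere (`MemX.ae_enorm_le`),
so `bliss_inequality` gives Σ_p ≤ C (`sobolevSup_le_blissConst`). Bliss' inequality is proved by
mass transport. For v > 0 continuous and u(r) = ∫_r^1 v, let y(r) be the point at which the Bliss
profile g(t) = (1 + t^((d-a)/(p-1)))^(-a/(d-a)) has accumulated the mass ∫_0^r s^(d-1) u^q. A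
calibration W built from r, u and y is nondecreasing, because its derivative is nonnegative by a
weighted AM-GM inequality and a Young inequality, both equalities for u = g, y = r
(`calibration_nonneg`). Comparing W at the two endpoints bounds the energy below
(`blissPotential_le_energy`). Exhausting the profile gives the sharp constant, and density with
Fatou's lemma gives general v.

Lower bound: (i) is not a pointwise comparison, since |ln(τ + |u|)| may be less than 1. Instead one
tests with profiles g(Rr) - g(R), normalized in energy, which concentrate at 0. On r < R^(η-1) with
η < (p-1)/p they are so large that the logarithmic factor is at least e^(r^β) ≥ 1 + r^β, a gain of
order R^(-β). Cutting off at R^(η-1) costs O(R^(-ηd/(p-1))) and subtracting g(R) costs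
O(R^(-a/(p-1))). Letting R → ∞ gives C ≤ 𝓕 for every β > 0, hence (i). If β < d/p and β < a/(p-1),
some η makes the gain win, hence (ii).

For (iii), |u(r)| ≤ r^(-α₁/p) uniformly on the unit sphere. On r ≤ 1 - δ the logarithmic factor is
then bounded by a constant tending to 1 as β → ∞, and the layer (1 - δ, 1) contributes O(δ)
uniformly in β (`supF_le`). -/

/-! ### Weighted spaces and pointwise bounds for elements of X. -/

lemma volume_restrict_absolutelyContinuous_weight (a : ℝ) :
    volume.restrict (Ioo (0 : ℝ) 1) ≪ weight a := by
  refine withDensity_absolutelyContinuous' (by fun_prop) ?_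
  filter_upwards [ae_restrict_mem measurableSet_Ioo] with r hr
  simpa using Real.rpow_pos_of_pos hr.1 a

lemma weight_absolutelyContinuous (a : ℝ) :
    weight a ≪ volume.restrict (Ioo (0 : ℝ) 1) :=
  withDensity_absolutelyContinuous _ _

lemma MemLpW.aemeasurable {p a : ℝ} {f : ℝ → ℝ} (hf : MemLpW p a f) :
    AEMeasurable f (volume.restrict (Ioo (0 : ℝ) 1)) :=
  (hf.1.mono_ac (volume_restrict_absolutelyContinuous_weight a)).aemeasurable

lemma wNorm_rpow {p : ℝ} (hp : 0 < p) (a : ℝ) (f : ℝ → ℝ) :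
    wNorm p a f ^ p = ∫⁻ r in Ioo (0 : ℝ) 1, ENNReal.ofReal (r ^ a) * ‖f r‖ₑ ^ p := by
  rw [wNorm, eLpNorm_eq_lintegral_rpow_enorm_toReal (by simpa using hp) (by simp),
    ENNReal.toReal_ofReal hp.le, ← ENNReal.rpow_mul, one_div_mul_cancel hp.ne', ENNReal.rpow_one,
    weight, lintegral_withDensity_eq_lintegral_mul_non_measurable _ (by fun_prop)]
  · rfl
  · exact Eventually.of_forall fun _ => ENNReal.ofReal_lt_top

/-- Hölder's inequality on `(r, 1)` against the weight. -/
lemma lintegral_enorm_le {p α : ℝ} (hp : 1 < p) (hα : 0 ≤ α) {f : ℝ → ℝ}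
    (hf : AEMeasurable f (volume.restrict (Ioo (0 : ℝ) 1))) {r : ℝ} (hr : r ∈ Ioo (0 : ℝ) 1) :
    ∫⁻ s in Ioo r 1, ‖f s‖ₑ ≤ ENNReal.ofReal (r ^ (-(α / p))) * wNorm p α f := by
  have hp0 : 0 < p := by linarith
  have hsub : Ioo r 1 ⊆ Ioo (0 : ℝ) 1 := Ioo_subset_Ioo_left hr.1.le
  have hf' : AEMeasurable f (volume.restrict (Ioo r 1)) :=
    hf.mono_measure (Measure.restrict_mono_set _ hsub)
  have h1 : ∫⁻ s in Ioo r 1, ‖f s‖ₑ ≤ (∫⁻ s in Ioo r 1, ‖f s‖ₑ ^ p) ^ (1 / p) := by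
    have := ENNReal.lintegral_mul_le_Lp_mul_Lq (volume.restrict (Ioo r 1))
      (Real.HolderConjugate.conjExponent hp) hf'.enorm (g := 1) aemeasurable_const
    simp only [Pi.mul_apply, Pi.one_apply, mul_one, ENNReal.one_rpow, lintegral_const, one_mul,
      Measure.restrict_apply MeasurableSet.univ, univ_inter, Real.volume_Ioo] at this
    refine this.trans (mul_le_of_le_one_right' ?_)
    refine ENNReal.rpow_le_one ?_ (by
      have := (Real.HolderConjugate.conjExponent hp).symm.pos
      positivity)
    rw [ENNReal.ofReal_le_one]; linarith [hr.1]
  -- On (r, 1) the weight s^α is at least r^α because α ≥ 0.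
  have h2 : ENNReal.ofReal (r ^ α) * ∫⁻ s in Ioo r 1, ‖f s‖ₑ ^ p ≤ wNorm p α f ^ p := by
    rw [wNorm_rpow hp0, ← lintegral_const_mul' _ _ ENNReal.ofReal_ne_top]
    refine le_trans ?_ (lintegral_mono_set hsub)
    refine setLIntegral_mono_ae (by fun_prop) (Eventually.of_forall fun s hs => ?_)
    gcongr
    · exact hr.1.le
    · exact hs.1.le
  have hrα : 0 < r ^ α := Real.rpow_pos_of_pos hr.1 _
  have h3 : ∫⁻ s in Ioo r 1, ‖f s‖ₑ ^ p ≤ ENNReal.ofReal (r ^ (-α)) * wNorm p α f ^ p := by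
    rw [Real.rpow_neg hr.1.le, ENNReal.ofReal_inv_of_pos hrα, mul_comm, ← div_eq_mul_inv,
      ENNReal.le_div_iff_mul_le (by simp [hrα]) (by simp), mul_comm]
    exact h2
  refine h1.trans ((ENNReal.rpow_le_rpow h3 (by positivity)).trans_eq ?_)
  rw [ENNReal.mul_rpow_of_nonneg _ _ (by positivity), ← ENNReal.rpow_mul,
    mul_one_div_cancel hp0.ne', ENNReal.rpow_one,
    ENNReal.ofReal_rpow_of_pos (Real.rpow_pos_of_pos hr.1 _), ← Real.rpow_mul hr.1.le]
  congr 3; ring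

lemma PreX.enorm_le {p α₀ α₁ : ℝ} {w : ℝ → ℝ} (hw : PreX p α₀ α₁ w) {r : ℝ}
    (hr : r ∈ Ioo (0 : ℝ) 1) : ‖w r‖ₑ ≤ ∫⁻ s in Ioo r 1, ‖deriv w s‖ₑ := by
  have key : ∀ b ∈ Ioo r 1, ‖w r‖ₑ ≤ ‖w b‖ₑ + ∫⁻ s in Ioo r 1, ‖deriv w s‖ₑ := by
    intro b hb
    have hint := (hw.1 r b hr.1 hb.1.le hb.2).integral_deriv_eq_sub
    have e : w r = w b - ∫ s in r..b, deriv w s := by rw [hint]; ring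
    calc ‖w r‖ₑ ≤ ‖w b‖ₑ + ‖∫ s in r..b, deriv w s‖ₑ := by rw [e]; exact enorm_sub_le
      _ ≤ _ := by
        gcongr
        rw [intervalIntegral.integral_of_le hb.1.le]
        refine (enorm_integral_le_lintegral_enorm _).trans (lintegral_mono_set ?_)
        exact Ioc_subset_Ioo_right hb.2
  have ht : Tendsto (fun b => ‖w b‖ₑ + ∫⁻ s in Ioo r 1, ‖deriv w s‖ₑ) (𝓝[<] 1)
      (𝓝 (‖(0 : ℝ)‖ₑ + ∫⁻ s in Ioo r 1, ‖deriv w s‖ₑ)) :=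
    (hw.2.1.enorm).add tendsto_const_nhds
  rw [enorm_zero, zero_add] at ht
  exact ge_of_tendsto ht (by filter_upwards [Ioo_mem_nhdsLT hr.2] with b hb using key b hb)

/-- An element of `X` is dominated a.e. by the integral of the modulus of its derivative. -/
lemma MemX.ae_enorm_le {p α₀ α₁ : ℝ} (hp : 1 < p) (hα₁ : 0 ≤ α₁) {u v : ℝ → ℝ}
    (h : MemX p α₀ α₁ u v) :
    ∀ᵐ r ∂volume.restrict (Ioo (0 : ℝ) 1), ‖u r‖ₑ ≤ ∫⁻ s in Ioo r 1, ‖v s‖ₑ := by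
  have hp0 : 0 < p := by linarith
  obtain ⟨hu, hv, happ⟩ := h
  choose w hw hlt using fun n : ℕ => happ ((n : ℝ≥0∞) + 1)⁻¹ (by simp)
  have hsmall : Tendsto (fun n : ℕ => ((n : ℝ≥0∞) + 1)⁻¹) atTop (𝓝 0) := by
    have := (tendsto_add_atTop_iff_nat 1).2 ENNReal.tendsto_inv_nat_nhds_zero
    simpa using this
  have hle1 : ∀ A B : ℝ≥0∞, A ≤ (A ^ p + B ^ p) ^ (1 / p) := fun A B => by
    calc A = (A ^ p) ^ (1 / p) := by
          rw [← ENNReal.rpow_mul, mul_one_div_cancel hp0.ne', ENNReal.rpow_one]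
      _ ≤ _ := ENNReal.rpow_le_rpow le_self_add (by positivity)
  have hU : Tendsto (fun n => wNorm p α₀ (w n - u)) atTop (𝓝 0) := by
    refine tendsto_of_tendsto_of_tendsto_of_le_of_le tendsto_const_nhds hsmall
      (fun _ => zero_le) fun n => ?_
    refine le_trans ?_ (hlt n).le
    rw [wNorm, eLpNorm_sub_comm]
    exact hle1 _ _
  have hV : Tendsto (fun n => wNorm p α₁ (v - deriv (w n))) atTop (𝓝 0) := by
    refine tendsto_of_tendsto_of_tendsto_of_le_of_le tendsto_const_nhds hsmall
      (fun _ => zero_le) fun n => ?_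
    refine le_trans ?_ (hlt n).le
    rw [xNorm, add_comm]
    exact hle1 _ _
  have hm := tendstoInMeasure_of_tendsto_eLpNorm (μ := weight α₀) (p := ENNReal.ofReal p)
    (by simpa using hp0) (fun n => (hw n).2.2.1.1) hu.1 hU
  -- Norm convergence only gives pointwise convergence along a subsequence. Hölder's inequality
  -- controls the error in the derivatives at each fixed r > 0.
  obtain ⟨ns, hns, hae⟩ := hm.exists_seq_tendsto_ae
  filter_upwards [(volume_restrict_absolutelyContinuous_weight α₀).ae_le hae,
    ae_restrict_mem measurableSet_Ioo] with r hr hr1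
  have hbd : ∀ n, ‖w (ns n) r‖ₑ ≤ (∫⁻ s in Ioo r 1, ‖v s‖ₑ) +
      ENNReal.ofReal (r ^ (-(α₁ / p))) * wNorm p α₁ (v - deriv (w (ns n))) := fun n => by
    have hmeas : AEMeasurable v (volume.restrict (Ioo r 1)) :=
      hv.aemeasurable.mono_measure (Measure.restrict_mono_set _ (Ioo_subset_Ioo_left hr1.1.le))
    refine ((hw _).enorm_le hr1).trans ?_
    have hH := lintegral_enorm_le hp hα₁ (f := v - deriv (w (ns n)))
      (hv.aemeasurable.sub (hw (ns n)).2.2.2.aemeasurable) hr1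
    refine le_trans ?_ (add_le_add_right hH _)
    rw [← lintegral_add_left' hmeas.enorm]
    refine lintegral_mono fun s => ?_
    have : deriv (w (ns n)) s = v s - (v - deriv (w (ns n))) s := by simp
    calc ‖deriv (w (ns n)) s‖ₑ = ‖v s - (v - deriv (w (ns n))) s‖ₑ := by rw [← this]
      _ ≤ _ := enorm_sub_le
  have ht : Tendsto (fun n => (∫⁻ s in Ioo r 1, ‖v s‖ₑ) +
      ENNReal.ofReal (r ^ (-(α₁ / p))) * wNorm p α₁ (v - deriv (w (ns n)))) atTop
      (𝓝 ((∫⁻ s in Ioo r 1, ‖v s‖ₑ) + ENNReal.ofReal (r ^ (-(α₁ / p))) * 0)) :=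
    tendsto_const_nhds.add (ENNReal.Tendsto.const_mul (hV.comp hns.tendsto_atTop)
      (Or.inr ENNReal.ofReal_ne_top))
  rw [mul_zero, add_zero] at ht
  exact le_of_tendsto_of_tendsto' hr.enorm ht hbd

/-- The bound does not depend on u; this makes the limit β → ∞ uniform over the unit sphere. -/
lemma MemX.ae_abs_le {p α₀ α₁ : ℝ} (hp : 1 < p) (hα₁ : 0 ≤ α₁) {u v : ℝ → ℝ}
    (h : MemX p α₀ α₁ u v) (hv : wNorm p α₁ v = 1) :
    ∀ᵐ r ∂volume.restrict (Ioo (0 : ℝ) 1), |u r| ≤ r ^ (-(α₁ / p)) := by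
  filter_upwards [h.ae_enorm_le hp hα₁, ae_restrict_mem measurableSet_Ioo] with r hr hr1
  have := hr.trans (lintegral_enorm_le hp hα₁ h.2.1.aemeasurable hr1)
  rw [hv, mul_one, Real.enorm_eq_ofReal_abs] at this
  exact (ENNReal.ofReal_le_ofReal_iff (Real.rpow_nonneg hr1.1.le _)).1 this

/-! ### The limit β → ∞. -/

lemma abs_log_add_le {τ x : ℝ} (hτ : 0 < τ) (hx : 0 ≤ x) :
    |Real.log (τ + x)| ≤ |Real.log τ| + x / τ := by
  have e : τ + x = τ * (1 + x / τ) := by field_simp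
  have h1 : 0 ≤ x / τ := by positivity
  rw [e, Real.log_mul hτ.ne' (by positivity)]
  refine (abs_add_le _ _).trans (add_le_add_right ?_ _)
  rw [abs_of_nonneg (Real.log_nonneg (by linarith))]
  linarith [Real.log_le_sub_one_of_pos (show 0 < 1 + x / τ by positivity)]

lemma abs_log_rpow_le {τ x r s : ℝ} (hτ : 0 < τ) (hr : 0 < r) (hr1 : r < 1) (hs : 0 ≤ s)
    (hx : 0 ≤ x) (hxr : x ≤ r ^ (-s)) {e : ℝ} (he : 0 ≤ e) :
    |Real.log (τ + x)| ^ e ≤ ((1 + |Real.log τ| + 1 / τ) * r ^ (-s)) ^ e := by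
  have h1 : 1 ≤ r ^ (-s) := Real.one_le_rpow_of_pos_of_le_one_of_nonpos hr hr1.le (by linarith)
  refine Real.rpow_le_rpow (abs_nonneg _) ((abs_log_add_le hτ hx).trans ?_) he
  have h2 : x / τ ≤ 1 / τ * r ^ (-s) := by
    rw [div_eq_mul_inv, mul_comm, one_div]; gcongr
  nlinarith [abs_nonneg (Real.log τ)]

lemma mul_rpow_rpow_le {K r s δ β : ℝ} (hK : 1 ≤ K) (hs : 0 ≤ s) (hr : 0 < r) (hδ : 0 < δ)
    (hrδ : r ≤ 1 - δ) (hβ : 1 ≤ β) :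
    (K * r ^ (-s)) ^ r ^ β ≤ Real.exp ((1 - δ) ^ (β - 1) * (Real.log K + s)) := by
  have hr1 : r < 1 := by linarith
  have hrs : 0 < r ^ (-s) := Real.rpow_pos_of_pos hr _
  rw [Real.rpow_def_of_pos (by positivity), Real.log_mul (by positivity) hrs.ne',
    Real.log_rpow hr]
  refine Real.exp_le_exp.2 ?_
  have hlK : 0 ≤ Real.log K := Real.log_nonneg hK
  have h1 : -Real.log r ≤ 1 / r := by
    have := Real.one_sub_inv_le_log_of_pos hr
    rw [one_div]; linarith
  -- One factor r absorbs the singularity of the logarithm at 0, since -r log r ≤ 1; the remaining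
  -- r^(β-1) is at most (1-δ)^(β-1).
  have h2 : r ^ β = r ^ (β - 1) * r := by
    rw [← Real.rpow_add_one hr.ne']; ring_nf
  have h3 : (Real.log K + -s * Real.log r) * r ≤ Real.log K + s := by
    have h4 : -s * Real.log r * r ≤ s := by
      have : -s * Real.log r * r = s * (-Real.log r * r) := by ring
      rw [this]
      have h5 : -Real.log r * r ≤ 1 := by
        calc -Real.log r * r ≤ 1 / r * r := by gcongr
          _ = 1 := by field_simp
      nlinarith
    nlinarith
  calc (Real.log K + -s * Real.log r) * r ^ β
      = r ^ (β - 1) * ((Real.log K + -s * Real.log r) * r) := by rw [h2]; ring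
    _ ≤ r ^ (β - 1) * (Real.log K + s) := by gcongr
    _ ≤ _ := by gcongr

/-- Away from 0 all powers of r are bounded, and an exponent in [0, 1] on the logarithm can be
replaced by 1. The bound is independent of e, hence of β. -/
lemma integrand_le_of_half_le {τ x r s θ q e : ℝ} (hτ : 0 < τ) (hr : 1 / 2 ≤ r) (hr1 : r < 1)
    (hs : 0 ≤ s) (hq : 0 ≤ q) (hx : 0 ≤ x) (hxr : x ≤ r ^ (-s)) (he : 0 ≤ e) (he1 : e ≤ 1) :
    r ^ θ * x ^ q * |Real.log (τ + x)| ^ e ≤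
      2 ^ |θ| * (2 ^ s) ^ q * ((1 + |Real.log τ| + 1 / τ) * 2 ^ s) := by
  have hr0 : 0 < r := by linarith
  have hrs : ∀ t : ℝ, r ^ (-t) ≤ 2 ^ |t| := fun t => by
    rw [Real.rpow_neg hr0.le, ← Real.inv_rpow hr0.le]
    have h2 : r⁻¹ ≤ 2 := by rw [inv_le_comm₀ hr0 two_pos]; linarith
    have h3 : 1 ≤ r⁻¹ := (one_le_inv₀ hr0).2 hr1.le
    calc r⁻¹ ^ t ≤ r⁻¹ ^ |t| := Real.rpow_le_rpow_of_exponent_le h3 (le_abs_self t)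
      _ ≤ _ := by gcongr
  have hs2 : r ^ (-s) ≤ 2 ^ s := by simpa [abs_of_nonneg hs] using hrs s
  have hθ : r ^ θ ≤ 2 ^ |θ| := by simpa using hrs (-θ)
  have hL := abs_log_rpow_le hτ hr0 hr1 hs hx hxr he
  have hK : 1 ≤ (1 + |Real.log τ| + 1 / τ) * r ^ (-s) := by
    have h1 : 1 ≤ r ^ (-s) :=
      Real.one_le_rpow_of_pos_of_le_one_of_nonpos hr0 hr1.le (by linarith)
    have : 0 ≤ |Real.log τ| + 1 / τ := by positivity
    nlinarith
  have hL2 : ((1 + |Real.log τ| + 1 / τ) * r ^ (-s)) ^ e ≤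
      (1 + |Real.log τ| + 1 / τ) * 2 ^ s := by
    calc _ ≤ ((1 + |Real.log τ| + 1 / τ) * r ^ (-s)) ^ (1 : ℝ) :=
          Real.rpow_le_rpow_of_exponent_le hK he1
      _ ≤ _ := by rw [Real.rpow_one]; gcongr
  have hxq : x ^ q ≤ (2 ^ s) ^ q := Real.rpow_le_rpow hx (hxr.trans hs2) hq
  have := hL.trans hL2
  gcongr

/-- The integral is split at 1 - δ: below, the logarithmic factor is nearly 1 for large β; above,
the integrand is bounded on a set of length δ. -/
lemma supF_le {p α₀ α₁ θ τ : ℝ} (hp : 1 < p) (hα₁ : 0 < α₁ - p + 1) (hθ : α₁ - p < θ)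
    (hτ : 0 < τ) {δ β : ℝ} (hδ : 0 < δ) (hδ2 : δ ≤ 1 / 2) (hβ : 1 ≤ β) :
    supF p α₀ α₁ θ τ β ≤
      ENNReal.ofReal (Real.exp ((1 - δ) ^ (β - 1) *
        (Real.log (1 + |Real.log τ| + 1 / τ) + α₁ / p))) * sobolevSup p α₀ α₁ θ +
      ENNReal.ofReal (2 ^ |θ| * (2 ^ (α₁ / p)) ^ critExp p α₁ θ *
        ((1 + |Real.log τ| + 1 / τ) * 2 ^ (α₁ / p))) * ENNReal.ofReal δ := by
  have hα0 : 0 ≤ α₁ := by linarith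
  have hs : 0 ≤ α₁ / p := div_nonneg hα0 (by linarith)
  have hq : 0 ≤ critExp p α₁ θ := by
    have : 0 < θ + 1 := by linarith
    have : 0 < p := by linarith
    unfold critExp; positivity
  have hK : 1 ≤ 1 + |Real.log τ| + 1 / τ := by
    have : 0 ≤ |Real.log τ| + 1 / τ := by positivity
    linarith
  refine iSup_le fun u => iSup_le fun v => iSup_le fun hX => iSup_le fun hv => ?_
  set E := Real.exp ((1 - δ) ^ (β - 1) * (Real.log (1 + |Real.log τ| + 1 / τ) + α₁ / p))
  set C := 2 ^ |θ| * (2 ^ (α₁ / p)) ^ critExp p α₁ θ *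
        ((1 + |Real.log τ| + 1 / τ) * 2 ^ (α₁ / p))
  have hpt : ∀ᵐ r ∂volume.restrict (Ioo (0 : ℝ) 1),
      ENNReal.ofReal (r ^ θ * |u r| ^ critExp p α₁ θ * |Real.log (τ + |u r|)| ^ r ^ β) ≤
      ENNReal.ofReal E * ENNReal.ofReal (r ^ θ * |u r| ^ critExp p α₁ θ) +
        (Ioo (1 - δ) 1).indicator (fun _ => ENNReal.ofReal C) r := by
    filter_upwards [hX.ae_abs_le hp hα0 hv, ae_restrict_mem measurableSet_Ioo] with r hr hr1
    rcases le_or_gt r (1 - δ) with h | h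
    · refine le_add_right ?_
      rw [← ENNReal.ofReal_mul (Real.exp_nonneg _)]
      refine ENNReal.ofReal_le_ofReal ?_
      rw [mul_comm E]
      have : 0 ≤ r ^ θ := Real.rpow_nonneg hr1.1.le _
      gcongr
      exact (abs_log_rpow_le hτ hr1.1 hr1.2 hs (abs_nonneg _) hr
        (Real.rpow_nonneg hr1.1.le _)).trans (mul_rpow_rpow_le hK hs hr1.1 hδ h hβ)
    · refine le_add_left ?_
      rw [indicator_of_mem (show r ∈ Ioo (1 - δ) 1 from ⟨h, hr1.2⟩)]
      exact ENNReal.ofReal_le_ofReal (integrand_le_of_half_le hτ (by linarith) hr1.2 hs hq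
        (abs_nonneg _) hr (Real.rpow_nonneg hr1.1.le _)
        (Real.rpow_le_one hr1.1.le hr1.2.le (by linarith)))
  refine (lintegral_mono_ae hpt).trans ?_
  rw [lintegral_add_right _ (measurable_const.indicator measurableSet_Ioo),
    lintegral_const_mul' _ _ ENNReal.ofReal_ne_top]
  gcongr
  · exact le_iSup₂_of_le u v (le_iSup₂_of_le hX hv le_rfl)
  · rw [lintegral_indicator_const measurableSet_Ioo]
    gcongr
    refine (Measure.restrict_apply_le _ _).trans ?_
    rw [Real.volume_Ioo]
    exact ENNReal.ofReal_le_ofReal (by linarith)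

lemma tendsto_supF {p α₀ α₁ θ τ : ℝ} (hp : 1 < p) (hα₁ : 0 < α₁ - p + 1) (hθ : α₁ - p < θ)
    (hτ : 0 < τ) (hle : ∀ β : ℝ, 0 < β → sobolevSup p α₀ α₁ θ ≤ supF p α₀ α₁ θ τ β) :
    Tendsto (fun β : ℝ => supF p α₀ α₁ θ τ β) atTop (𝓝 (sobolevSup p α₀ α₁ θ)) := by
  rw [tendsto_order]
  refine ⟨fun c hc => ?_, fun c hc => ?_⟩
  · filter_upwards [eventually_gt_atTop 0] with β hβ using hc.trans_le (hle β hβ)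
  have hfin : sobolevSup p α₀ α₁ θ ≠ ⊤ := (hc.trans_le le_top).ne
  set L := Real.log (1 + |Real.log τ| + 1 / τ) + α₁ / p with hL
  set C := 2 ^ |θ| * (2 ^ (α₁ / p)) ^ critExp p α₁ θ *
        ((1 + |Real.log τ| + 1 / τ) * 2 ^ (α₁ / p)) with hC
  have h1 : Tendsto (fun δ : ℝ => sobolevSup p α₀ α₁ θ +
      ENNReal.ofReal C * ENNReal.ofReal δ) (𝓝[>] 0) (𝓝 (sobolevSup p α₀ α₁ θ +
      ENNReal.ofReal C * ENNReal.ofReal 0)) :=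
    ((tendsto_const_nhds (f := 𝓝 (0 : ℝ))).add (ENNReal.Tendsto.const_mul
      (ENNReal.tendsto_ofReal tendsto_id) (Or.inr ENNReal.ofReal_ne_top))).mono_left
        nhdsWithin_le_nhds
  rw [ENNReal.ofReal_zero, mul_zero, add_zero] at h1
  -- The width of the boundary layer is fixed first, independently of β; only then does β tend to
  -- infinity.
  obtain ⟨δ, hδc, hδ⟩ := ((h1.eventually_lt_const hc).and
    (Ioc_mem_nhdsGT (show (0 : ℝ) < 1 / 2 by norm_num))).exists
  have h2 : Tendsto (fun β : ℝ => (1 - δ) ^ (β - 1)) atTop (𝓝 0) :=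
    (tendsto_rpow_atTop_of_base_lt_one (1 - δ) (by linarith [hδ.2]) (by linarith [hδ.1])).comp
      (tendsto_atTop_add_const_right _ (-1) tendsto_id)
  have h3 : Tendsto (fun β : ℝ => ENNReal.ofReal (Real.exp ((1 - δ) ^ (β - 1) * L)) *
      sobolevSup p α₀ α₁ θ + ENNReal.ofReal C * ENNReal.ofReal δ) atTop
      (𝓝 (ENNReal.ofReal (Real.exp (0 * L)) *
      sobolevSup p α₀ α₁ θ + ENNReal.ofReal C * ENNReal.ofReal δ)) :=
    (ENNReal.Tendsto.mul_const (ENNReal.tendsto_ofReal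
      (Real.continuous_exp.continuousAt.tendsto.comp (h2.mul_const L))) (Or.inr hfin)).add
      tendsto_const_nhds
  rw [zero_mul, Real.exp_zero, ENNReal.ofReal_one, one_mul] at h3
  filter_upwards [h3.eventually_lt_const hδc, eventually_ge_atTop 1] with β hβ hβ1
  exact (supF_le hp hα₁ hθ hτ hδ.1 hδ.2 hβ1).trans_lt hβ

/-! ### Pointwise inequalities behind the calibration. -/

/-- The growth coefficient in the weighted Young inequality. -/
noncomputable def youngCoef (p a d : ℝ) : ℝ := (d * (p - 1) + a) / a / p * (a / (p - 1)) ^ (-(p - 1))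

/-- Weighted AM-GM with weights 1 - w and w, where w = (d-a)/(pd). This w makes the powers of y
cancel in the geometric mean and leaves Y to the power 1. With Y = 1 + y^((d-a)/(p-1)), equality
holds when y = r and u is the Bliss profile. -/
lemma amgm_bound {p a d r u y Y : ℝ} (hp : 1 < p) (ha : 0 < a) (hd : a < d)
    (hr : 0 < r) (hu : 0 < u) (hy : 0 < y) (hY : 0 < Y) :
    d * (r ^ (d - 1) * u ^ (d * p / a) * Y) ≤
      (d - (d - a) / p) * (r ^ (d - (d - a) / p - 1) * u ^ ((d * (p - 1) + a) / a) *
        y ^ ((d - a) / p)) +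
      (d - a) / p * (r ^ (d - (d - a) / p) * u ^ ((d * (p - 1) + a) / a) *
        y ^ ((d - a) / p - 1) *
        (r ^ (d - 1) * u ^ (d * p / a) * (y ^ (d - 1) * Y ^ (-(d * p / (d - a))))⁻¹)) := by
  have hd0 : 0 < d := ha.trans hd
  have hda : 0 < d - a := sub_pos.2 hd
  have hp0 : 0 < p := by linarith
  have hw2 : 0 ≤ (d - a) / p / d := by positivity
  have hw1 : 0 ≤ 1 - (d - a) / p / d := by
    rw [sub_nonneg, div_le_one hd0, div_le_iff₀ hp0]; nlinarith
  set P := r ^ (d - (d - a) / p - 1) * u ^ ((d * (p - 1) + a) / a) * y ^ ((d - a) / p) with hP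
  set Q := r ^ (d - (d - a) / p) * u ^ ((d * (p - 1) + a) / a) *
        y ^ ((d - a) / p - 1) *
        (r ^ (d - 1) * u ^ (d * p / a) * (y ^ (d - 1) * Y ^ (-(d * p / (d - a))))⁻¹) with hQ
  have h := Real.geom_mean_le_arith_mean2_weighted hw1 hw2 (show 0 ≤ P by positivity)
    (show 0 ≤ Q by positivity) (by ring)
  have e : P ^ (1 - (d - a) / p / d) * Q ^ ((d - a) / p / d) =
      r ^ (d - 1) * u ^ (d * p / a) * Y := by
    rw [hP, hQ]
    -- Writing every positive quantity as an exponential turns the identity of monomials into a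
    -- linear identity between exponents.
    obtain ⟨r, rfl⟩ : ∃ x, r = Real.exp x := ⟨_, (Real.exp_log hr).symm⟩
    obtain ⟨u, rfl⟩ : ∃ x, u = Real.exp x := ⟨_, (Real.exp_log hu).symm⟩
    obtain ⟨y, rfl⟩ : ∃ x, y = Real.exp x := ⟨_, (Real.exp_log hy).symm⟩
    obtain ⟨Y, rfl⟩ : ∃ x, Y = Real.exp x := ⟨_, (Real.exp_log hY).symm⟩
    simp only [← Real.exp_mul, ← Real.exp_add, ← Real.exp_neg]
    congr 1
    field_simp
    ring
  rw [e] at h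
  calc d * (r ^ (d - 1) * u ^ (d * p / a) * Y)
      ≤ d * ((1 - (d - a) / p / d) * P + (d - a) / p / d * Q) := by gcongr
    _ = _ := by field_simp

lemma young_bound {p a d r u y v : ℝ} (hp : 1 < p) (ha : 0 < a) (hd : a < d)
    (hr : 0 < r) (hu : 0 < u) (hy : 0 < y) (hv : 0 < v) :
    (d * (p - 1) + a) / a * (r ^ (d - (d - a) / p) * u ^ ((d * (p - 1) + a) / a - 1) * v *
        y ^ ((d - a) / p)) ≤
      youngCoef p a d * (r ^ (a + p - 1) * v ^ p) +
      (d * (p - 1) + a) / p * (r ^ (d - 1) * u ^ (d * p / a) * y ^ ((d - a) / (p - 1))) := by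
  have hd0 : 0 < d := ha.trans hd
  have hda : 0 < d - a := sub_pos.2 hd
  have hp0 : 0 < p := by linarith
  have hp1 : 0 < p - 1 := by linarith
  have hpne : p - 1 ≠ 0 := hp1.ne'
  have hh : 0 < a / (p - 1) := by positivity
  obtain ⟨h, hhe⟩ : ∃ x, a / (p - 1) = Real.exp x := ⟨_, (Real.exp_log hh).symm⟩
  have hl : 0 < Real.exp (-h * (p - 1) / p) := Real.exp_pos _
  -- The balancing factor is (a/(p-1))^(-(p-1)/p), chosen so that Young's inequality is an equality
  -- when u is the Bliss profile, v minus its derivative, and y = r.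
  set X := Real.exp (-h * (p - 1) / p) * (r ^ ((a + p - 1) / p) * v) with hX
  set Z := (Real.exp (-h * (p - 1) / p))⁻¹ *
    (r ^ ((d - 1) * (p - 1) / p) * u ^ ((d * (p - 1) + a) / a - 1) * y ^ ((d - a) / p)) with hZ
  have hk : 0 ≤ (d * (p - 1) + a) / a := by positivity
  have hY := mul_le_mul_of_nonneg_left
    (Real.young_inequality_of_nonneg (show 0 ≤ X by positivity) (show 0 ≤ Z by positivity)
    (Real.HolderConjugate.conjExponent hp)) hk
  refine (le_of_eq ?_).trans (hY.trans (le_of_eq ?_))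
  · rw [hX, hZ]
    congr 1
    obtain ⟨r, rfl⟩ : ∃ x, r = Real.exp x := ⟨_, (Real.exp_log hr).symm⟩
    obtain ⟨u, rfl⟩ : ∃ x, u = Real.exp x := ⟨_, (Real.exp_log hu).symm⟩
    obtain ⟨y, rfl⟩ : ∃ x, y = Real.exp x := ⟨_, (Real.exp_log hy).symm⟩
    obtain ⟨v, rfl⟩ : ∃ x, v = Real.exp x := ⟨_, (Real.exp_log hv).symm⟩
    simp only [← Real.exp_mul, ← Real.exp_add, ← Real.exp_neg]
    congr 1
    field_simp
    ring
  · rw [mul_add]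
    have e1 : X ^ p = (a / (p - 1)) ^ (-(p - 1)) * (r ^ (a + p - 1) * v ^ p) := by
      rw [hX, hhe]
      obtain ⟨r, rfl⟩ : ∃ x, r = Real.exp x := ⟨_, (Real.exp_log hr).symm⟩
      obtain ⟨v, rfl⟩ : ∃ x, v = Real.exp x := ⟨_, (Real.exp_log hv).symm⟩
      simp only [← Real.exp_mul, ← Real.exp_add]
      congr 1
      field_simp
    have e2 : Z ^ (p.conjExponent) =
        a / (p - 1) * (r ^ (d - 1) * u ^ (d * p / a) * y ^ ((d - a) / (p - 1))) := by
      rw [hZ, hhe, Real.conjExponent]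
      obtain ⟨r, rfl⟩ : ∃ x, r = Real.exp x := ⟨_, (Real.exp_log hr).symm⟩
      obtain ⟨u, rfl⟩ : ∃ x, u = Real.exp x := ⟨_, (Real.exp_log hu).symm⟩
      obtain ⟨y, rfl⟩ : ∃ x, y = Real.exp x := ⟨_, (Real.exp_log hy).symm⟩
      simp only [← Real.exp_mul, ← Real.exp_add, ← Real.exp_neg]
      congr 1
      field_simp
      ring
    rw [e1, e2, youngCoef, Real.conjExponent]
    congr 1
    · field_simp
    · field_simp

/-- The density `t ^ (d - 1) g(t) ^ q` of the Bliss profile `g(t) = (1 + t ^ b) ^ (-c)`. -/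
noncomputable def blissDensity (p a d t : ℝ) : ℝ :=
  t ^ (d - 1) * (1 + t ^ ((d - a) / (p - 1))) ^ (-(d * p / (d - a)))

/-- The right-hand side is the derivative of the calibration `W` used in `blissPotential_le_energy`.
It is the sum of the slacks in `amgm_bound` and `young_bound`. -/
lemma calibration_nonneg {p a d r u y v : ℝ} (hp : 1 < p) (ha : 0 < a) (hd : a < d)
    (hr : 0 < r) (hu : 0 < u) (hy : 0 < y) (hv : 0 < v) :
    0 ≤ (d - (d - a) / p) * r ^ (d - (d - a) / p - 1) * u ^ ((d * (p - 1) + a) / a) *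
        y ^ ((d - a) / p) -
      (d * (p - 1) + a) / a * (r ^ (d - (d - a) / p) * u ^ ((d * (p - 1) + a) / a - 1) * v *
        y ^ ((d - a) / p)) +
      (d - a) / p * (r ^ (d - (d - a) / p) * u ^ ((d * (p - 1) + a) / a) *
        y ^ ((d - a) / p - 1) *
        (r ^ (d - 1) * u ^ (d * p / a) * (blissDensity p a d y)⁻¹)) +
      youngCoef p a d * (r ^ (a + p - 1) * v ^ p) -
      r ^ (d - 1) * u ^ (d * p / a) * (d + (d - a) / p * y ^ ((d - a) / (p - 1))) := by
  have hp0 : p ≠ 0 := by linarith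
  have h1 := amgm_bound hp ha hd hr hu hy (show 0 < 1 + y ^ ((d - a) / (p - 1)) by positivity)
  have h2 := young_bound hp ha hd hr hu hy hv
  have h3 : d * (r ^ (d - 1) * u ^ (d * p / a) * (1 + y ^ ((d - a) / (p - 1)))) -
      (d * (p - 1) + a) / p * (r ^ (d - 1) * u ^ (d * p / a) * y ^ ((d - a) / (p - 1))) =
      r ^ (d - 1) * u ^ (d * p / a) * (d + (d - a) / p * y ^ ((d - a) / (p - 1))) := by
    field_simp
    ring
  rw [blissDensity]
  linarith

/-! ### Mass, moment and potential of the Bliss profile. -/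

/-- `G` need not be onto: the mass of the profile is bounded. Hence `J` is only described on the
image of (0, ∞). -/
lemma exists_hasDerivAt_inverse {G m : ℝ → ℝ} (hG : ∀ y, 0 < y → HasDerivAt G (m y) y)
    (hm : ∀ y, 0 < y → 0 < m y) :
    ∃ J : ℝ → ℝ, ∀ y, 0 < y → J (G y) = y ∧ HasDerivAt J (m y)⁻¹ (G y) := by
  have hcont : ContinuousOn G (Ioi 0) := fun y hy => (hG y hy).continuousAt.continuousWithinAt
  have hmono : StrictMonoOn G (Ioi 0) := by
    refine strictMonoOn_of_deriv_pos (convex_Ioi 0) hcont fun y hy => ?_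
    rw [interior_Ioi] at hy
    rw [(hG y hy).deriv]; exact hm y hy
  have hJ : ∀ y, 0 < y → Function.invFunOn G (Ioi 0) (G y) = y := fun y hy =>
    hmono.injOn.leftInvOn_invFunOn hy
  refine ⟨Function.invFunOn G (Ioi 0), fun y hy => ⟨hJ y hy, ?_⟩⟩
  have hnhds : G '' Ioi 0 ∈ 𝓝 (G y) := by
    have h1 : G (y / 2) < G y := hmono (half_pos hy) hy (by linarith)
    have h2 : G y < G (2 * y) := hmono hy (show 0 < 2 * y by linarith) (by linarith)
    refine mem_of_superset (Ioo_mem_nhds h1 h2) ?_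
    refine (intermediate_value_Ioo (by linarith) (hcont.mono fun x hx => ?_)).trans
      (image_mono fun x hx => ?_)
    · exact (half_pos hy).trans_le hx.1
    · exact (half_pos hy).trans hx.1
  have hcJ : ContinuousAt (Function.invFunOn G (Ioi 0)) (G y) := by
    refine StrictMonoOn.continuousAt_of_image_mem_nhds (s := G '' Ioi 0) ?_ hnhds ?_
    · rintro _ ⟨x, hx, rfl⟩ _ ⟨z, hz, rfl⟩ h
      rw [hJ x hx, hJ z hz]
      exact (hmono.lt_iff_lt hx hz).1 h
    · rw [hJ y hy, image_image]
      refine mem_of_superset (Ioi_mem_nhds hy) fun x hx => ⟨x, hx, hJ x hx⟩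
  refine HasDerivAt.of_local_left_inverse (f := G) hcJ ?_ (hm y hy).ne' ?_
  · rw [hJ y hy]; exact hG y hy
  · filter_upwards [hnhds] with z hz
    obtain ⟨x, hx, rfl⟩ := hz
    rw [hJ x hx]

noncomputable def blissMass (p a d y : ℝ) : ℝ := ∫ t in (0 : ℝ)..y, blissDensity p a d t

/-- Up to the factor (a/(p-1))^p this is the energy of the profile on (0, y), by
`rpow_mul_slope_rpow`. -/
noncomputable def blissMoment (p a d y : ℝ) : ℝ :=
  ∫ t in (0 : ℝ)..y, t ^ ((d - a) / (p - 1)) * blissDensity p a d t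

lemma measurable_blissDensity (p a d : ℝ) : Measurable (blissDensity p a d) := by
  unfold blissDensity; fun_prop

lemma blissDensity_pos {p a d t : ℝ} (ht : 0 < t) : 0 < blissDensity p a d t := by
  unfold blissDensity; positivity

lemma continuousAt_blissDensity {p a d t : ℝ} (ht : 0 < t) :
    ContinuousAt (blissDensity p a d) t := by
  have h1 : ∀ e : ℝ, ContinuousAt (fun s : ℝ => s ^ e) t := fun e =>
    Real.continuousAt_rpow_const _ _ (Or.inl ht.ne')
  refine (h1 _).mul (ContinuousAt.rpow_const (continuousAt_const.add (h1 _)) (Or.inl ?_))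
  positivity

lemma intervalIntegrable_blissDensity {p a d y : ℝ} (hp : 1 < p) (ha : 0 < a) (hd : a < d)
    (hy : 0 ≤ y) : IntervalIntegrable (blissDensity p a d) volume 0 y := by
  have hb : 0 ≤ (d - a) / (p - 1) := div_nonneg (by linarith) (by linarith)
  refine (intervalIntegral.intervalIntegrable_rpow' (by linarith)).mul_continuousOn ?_
  rw [uIcc_of_le hy]
  refine ContinuousOn.rpow_const
    (continuous_const.add (Real.continuous_rpow_const hb)).continuousOn fun t ht => Or.inl ?_
  have : 0 ≤ t ^ ((d - a) / (p - 1)) := Real.rpow_nonneg ht.1 _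
  positivity

lemma intervalIntegrable_blissMoment {p a d y : ℝ} (hp : 1 < p) (ha : 0 < a) (hd : a < d)
    (hy : 0 ≤ y) : IntervalIntegrable
      (fun t => t ^ ((d - a) / (p - 1)) * blissDensity p a d t) volume 0 y :=
  (intervalIntegrable_blissDensity hp ha hd hy).continuousOn_mul
    (Real.continuous_rpow_const (div_nonneg (by linarith) (by linarith))).continuousOn

lemma hasDerivAt_blissMass {p a d y : ℝ} (hp : 1 < p) (ha : 0 < a) (hd : a < d) (hy : 0 < y) :
    HasDerivAt (blissMass p a d) (blissDensity p a d y) y :=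
  intervalIntegral.integral_hasDerivAt_right (intervalIntegrable_blissDensity hp ha hd hy.le)
    ((measurable_blissDensity p a d).stronglyMeasurable.stronglyMeasurableAtFilter)
    (continuousAt_blissDensity hy)

lemma hasDerivAt_blissMoment {p a d y : ℝ} (hp : 1 < p) (ha : 0 < a) (hd : a < d)
    (hy : 0 < y) : HasDerivAt (blissMoment p a d)
      (y ^ ((d - a) / (p - 1)) * blissDensity p a d y) y := by
  refine intervalIntegral.integral_hasDerivAt_right (intervalIntegrable_blissMoment hp ha hd hy.le)
    (StronglyMeasurable.stronglyMeasurableAtFilter ?_)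
    ((Real.continuousAt_rpow_const _ _ (Or.inl hy.ne')).mul (continuousAt_blissDensity hy))
  exact ((Measurable.pow_const measurable_id _).mul
    (measurable_blissDensity p a d)).stronglyMeasurable

lemma continuousOn_blissMass {p a d y : ℝ} (hp : 1 < p) (ha : 0 < a) (hd : a < d) (hy : 0 ≤ y) :
    ContinuousOn (blissMass p a d) (Icc 0 y) := by
  have := intervalIntegral.continuousOn_primitive_interval'
    (intervalIntegrable_blissDensity hp ha hd hy) left_mem_uIcc
  rwa [uIcc_of_le hy] at this

lemma continuousOn_blissMoment {p a d y : ℝ} (hp : 1 < p) (ha : 0 < a) (hd : a < d)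
    (hy : 0 ≤ y) : ContinuousOn (blissMoment p a d) (Icc 0 y) := by
  have := intervalIntegral.continuousOn_primitive_interval'
    (intervalIntegrable_blissMoment hp ha hd hy) left_mem_uIcc
  rwa [uIcc_of_le hy] at this

lemma strictMonoOn_blissMass {p a d : ℝ} (hp : 1 < p) (ha : 0 < a) (hd : a < d) :
    StrictMonoOn (blissMass p a d) (Ici 0) := by
  refine strictMonoOn_of_deriv_pos (convex_Ici 0) (fun y hy => ?_) fun y hy => ?_
  · have h := continuousOn_blissMass hp ha hd (show (0 : ℝ) ≤ y + 1 by linarith [mem_Ici.1 hy]) y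
      ⟨hy, by linarith⟩
    refine h.mono_of_mem_nhdsWithin ?_
    rw [← Ici_inter_Iic]
    exact inter_mem self_mem_nhdsWithin (mem_nhdsWithin_of_mem_nhds (Iic_mem_nhds (by linarith)))
  · rw [interior_Ici] at hy
    rw [(hasDerivAt_blissMass hp ha hd hy).deriv]
    exact blissDensity_pos hy

lemma blissMass_zero (p a d : ℝ) : blissMass p a d 0 = 0 := intervalIntegral.integral_same

lemma blissMass_pos {p a d y : ℝ} (hp : 1 < p) (ha : 0 < a) (hd : a < d) (hy : 0 < y) :
    0 < blissMass p a d y := by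
  rw [← blissMass_zero p a d]
  exact strictMonoOn_blissMass hp ha hd self_mem_Ici hy.le hy

/-- The value of the calibration along the Bliss profile. -/
noncomputable def blissPotential (p a d y : ℝ) : ℝ :=
  y ^ d * (1 + y ^ ((d - a) / (p - 1))) ^ (-((d * (p - 1) + a) / (d - a))) +
    (d * (p - 1) + a) / (p * (p - 1)) * blissMoment p a d y

/-- The boundary term contributes d - a/(p-1) · y^((d-a)/(p-1)) times the density; the coefficient
of the moment raises -a/(p-1) to the value (d-a)/p required by `calibration_nonneg`. -/
lemma hasDerivAt_blissPotential {p a d y : ℝ} (hp : 1 < p) (ha : 0 < a) (hd : a < d)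
    (hy : 0 < y) : HasDerivAt (blissPotential p a d)
      (blissDensity p a d y * (d + (d - a) / p * y ^ ((d - a) / (p - 1)))) y := by
  have hda : d - a ≠ 0 := (sub_pos.2 hd).ne'
  have hp1 : p - 1 ≠ 0 := (sub_pos.2 hp).ne'
  have hp0 : p ≠ 0 := by linarith
  have hY : 0 < 1 + y ^ ((d - a) / (p - 1)) := by positivity
  have h1 : HasDerivAt (fun y : ℝ => y ^ d) (d * y ^ (d - 1)) y :=
    Real.hasDerivAt_rpow_const (Or.inl hy.ne')
  have h2 : HasDerivAt (fun y : ℝ => 1 + y ^ ((d - a) / (p - 1)))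
      ((d - a) / (p - 1) * y ^ ((d - a) / (p - 1) - 1)) y :=
    (Real.hasDerivAt_rpow_const (Or.inl hy.ne')).const_add 1
  have h3 := h2.rpow_const (p := -((d * (p - 1) + a) / (d - a))) (Or.inl hY.ne')
  have h4 := (h1.mul h3).add ((hasDerivAt_blissMoment hp ha hd hy).const_mul
    ((d * (p - 1) + a) / (p * (p - 1))))
  refine h4.congr_deriv ?_
  have e1 : -((d * (p - 1) + a) / (d - a)) - 1 = -(d * p / (d - a)) := by field_simp; ring
  have e2 : (1 + y ^ ((d - a) / (p - 1))) ^ (-((d * (p - 1) + a) / (d - a))) =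
      (1 + y ^ ((d - a) / (p - 1))) ^ (-(d * p / (d - a))) * (1 + y ^ ((d - a) / (p - 1))) := by
    rw [← e1, Real.rpow_sub_one hY.ne']; field_simp
  have e3 : y ^ d = y ^ (d - 1) * y := by rw [Real.rpow_sub_one hy.ne']; field_simp
  have e4 : y ^ ((d - a) / (p - 1) - 1) = y ^ ((d - a) / (p - 1)) / y :=
    Real.rpow_sub_one hy.ne' _
  rw [e1, e2, e3, e4, blissDensity]
  field_simp
  ring

/-- The discarded boundary term is O(y^(-a/(p-1))), so sharpness is not lost as y → ∞. -/
lemma blissPotential_ge {p a d y : ℝ} (hy : 0 ≤ y) :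
    (d * (p - 1) + a) / (p * (p - 1)) * blissMoment p a d y ≤ blissPotential p a d y := by
  have : 0 ≤ y ^ d * (1 + y ^ ((d - a) / (p - 1))) ^ (-((d * (p - 1) + a) / (d - a))) := by
    positivity
  rw [blissPotential]; linarith

lemma continuousOn_blissPotential {p a d y : ℝ} (hp : 1 < p) (ha : 0 < a) (hd : a < d)
    (hy : 0 ≤ y) : ContinuousOn (blissPotential p a d) (Icc 0 y) := by
  have hb : 0 ≤ (d - a) / (p - 1) := div_nonneg (by linarith) (by linarith)
  refine ContinuousOn.add (ContinuousOn.mul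
    (Real.continuous_rpow_const (by linarith)).continuousOn (ContinuousOn.rpow_const
    (continuous_const.add (Real.continuous_rpow_const hb)).continuousOn fun t ht => Or.inl ?_))
    (continuousOn_const.mul (continuousOn_blissMoment hp ha hd hy))
  have : 0 ≤ t ^ ((d - a) / (p - 1)) := Real.rpow_nonneg ht.1 _
  positivity

lemma blissPotential_zero {p a d : ℝ} (ha : 0 < a) (hd : a < d) : blissPotential p a d 0 = 0 := by
  rw [blissPotential, blissMoment, intervalIntegral.integral_same, Real.zero_rpow (by linarith)]
  ring

lemma monotoneOn_blissPotential {p a d : ℝ} (hp : 1 < p) (ha : 0 < a) (hd : a < d) :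
    MonotoneOn (blissPotential p a d) (Ioi 0) := by
  have hda : 0 < d - a := sub_pos.2 hd
  have hd0 : 0 < d := by linarith
  have hp0 : 0 < p := by linarith
  refine monotoneOn_of_deriv_nonneg (convex_Ioi 0)
    (fun y hy => (hasDerivAt_blissPotential hp ha hd hy).continuousAt.continuousWithinAt)
    (fun y hy => ?_) fun y hy => ?_
  · rw [interior_Ioi] at hy
    exact (hasDerivAt_blissPotential hp ha hd hy).differentiableAt.differentiableWithinAt
  · rw [interior_Ioi] at hy
    rw [(hasDerivAt_blissPotential hp ha hd hy).deriv]
    have := blissDensity_pos (p := p) (a := a) (d := d) hy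
    have hy' : 0 < y := hy
    positivity

/-! ### The calibration argument. -/

/-- Along a positive decreasing function with the mass of the Bliss profile on `(0, y)`, the
calibration bounds the energy from below. -/
lemma blissPotential_le_energy {p a d y : ℝ} (hp : 1 < p) (ha : 0 < a) (hd : a < d)
    {v : ℝ → ℝ} (hv : Continuous v) (hpos : ∀ x, 0 < v x) (hy : 0 < y)
    (hM : ∫ r in (0 : ℝ)..1, r ^ (d - 1) * (∫ s in r..1, v s) ^ (d * p / a) =
      blissMass p a d y) :
    blissPotential p a d y ≤ youngCoef p a d * ∫ r in (0 : ℝ)..1, r ^ (a + p - 1) * v r ^ p := by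
  have hd0 : 0 < d := ha.trans hd
  have hda : 0 < d - a := sub_pos.2 hd
  have hp0 : 0 < p := by linarith
  have hp1 : 0 < p - 1 := by linarith
  have hA : 0 ≤ youngCoef p a d := by unfold youngCoef; positivity
  set u : ℝ → ℝ := fun r => ∫ s in r..1, v s with hu_def
  have hu : ∀ r, HasDerivAt u (-v r) r := fun r =>
    intervalIntegral.integral_hasDerivAt_left (hv.intervalIntegrable _ _)
      hv.stronglyMeasurable.stronglyMeasurableAtFilter hv.continuousAt
  have huc : Continuous u := continuous_iff_continuousAt.2 fun r => (hu r).continuousAt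
  have hupos : ∀ r, r < 1 → 0 < u r := fun r hr =>
    intervalIntegral.intervalIntegral_pos_of_pos (hv.intervalIntegrable _ _) hpos hr
  have hu1 : u 1 = 0 := intervalIntegral.integral_same
  set f : ℝ → ℝ := fun r => r ^ (d - 1) * u r ^ (d * p / a) with hf_def
  have hq : 0 < d * p / a := by positivity
  have hfi : IntervalIntegrable f volume 0 1 :=
    (intervalIntegral.intervalIntegrable_rpow' (by linarith)).mul_continuousOn
      (huc.rpow_const fun _ => Or.inr hq.le).continuousOn
  have hfi' : ∀ r ∈ Ioc (0 : ℝ) 1, IntervalIntegrable f volume 0 r := fun r hr =>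
    hfi.mono_set (by rw [uIcc_of_le hr.1.le, uIcc_of_le zero_le_one]; exact Icc_subset_Icc_right hr.2)
  have hfm : Measurable f := (measurable_id.pow_const _).mul (huc.measurable.pow_const _)
  have hfpos : ∀ r ∈ Ioo (0 : ℝ) 1, 0 < f r := fun r hr =>
    mul_pos (Real.rpow_pos_of_pos hr.1 _) (Real.rpow_pos_of_pos (hupos r hr.2) _)
  set M : ℝ → ℝ := fun r => ∫ s in (0 : ℝ)..r, f s with hM_def
  have hMd : ∀ r ∈ Ioo (0 : ℝ) 1, HasDerivAt M (f r) r := fun r hr =>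
    intervalIntegral.integral_hasDerivAt_right (hfi' r ⟨hr.1, hr.2.le⟩)
      hfm.stronglyMeasurable.stronglyMeasurableAtFilter
      ((Real.continuousAt_rpow_const _ _ (Or.inl hr.1.ne')).mul
        (huc.rpow_const fun _ => Or.inr hq.le).continuousAt)
  have hMc : ContinuousOn M (Icc 0 1) := by
    have := intervalIntegral.continuousOn_primitive_interval' hfi left_mem_uIcc
    rwa [uIcc_of_le zero_le_one] at this
  have hMmono : MonotoneOn M (Icc 0 1) := by
    refine monotoneOn_of_deriv_nonneg (convex_Icc 0 1) hMc (fun r hr => ?_) fun r hr => ?_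
    · rw [interior_Icc] at hr
      exact (hMd r hr).differentiableAt.differentiableWithinAt
    · rw [interior_Icc] at hr
      rw [(hMd r hr).deriv]; exact (hfpos r hr).le
  have hMpos : ∀ r ∈ Ioc (0 : ℝ) 1, 0 < M r := fun r hr =>
    intervalIntegral.intervalIntegral_pos_of_pos_on (hfi' r hr)
      (fun s hs => hfpos s ⟨hs.1, hs.2.trans_le hr.2⟩) hr.1
  have hM1 : M 1 = blissMass p a d y := hM
  have hM0 : M 0 = 0 := intervalIntegral.integral_same
  obtain ⟨J, hJ⟩ := exists_hasDerivAt_inverse (G := blissMass p a d) (m := blissDensity p a d)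
    (fun t ht => hasDerivAt_blissMass hp ha hd ht) (fun t ht => blissDensity_pos ht)
  -- The total mass on (0, 1) is that of the profile on (0, y), so every M r lies in the range of
  -- `blissMass` and the transport map r ↦ J (M r) is defined.
  have hex : ∀ r ∈ Ioc (0 : ℝ) 1, ∃ z, 0 < z ∧ blissMass p a d z = M r := fun r hr => by
    have h := intermediate_value_Ioc hy.le (continuousOn_blissMass hp ha hd hy.le)
    obtain ⟨z, hz, hzr⟩ := h (show M r ∈ Ioc (blissMass p a d 0) (blissMass p a d y) by
      rw [blissMass_zero, ← hM1]
      exact ⟨hMpos r hr, hMmono ⟨hr.1.le, hr.2⟩ (right_mem_Icc.2 zero_le_one) hr.2⟩)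
    exact ⟨z, hz.1, hzr⟩
  have hJpos : ∀ r ∈ Ioc (0 : ℝ) 1, 0 < J (M r) := fun r hr => by
    obtain ⟨z, hz, hzr⟩ := hex r hr
    rw [← hzr, (hJ z hz).1]; exact hz
  have hJd : ∀ r ∈ Ioc (0 : ℝ) 1, HasDerivAt J (blissDensity p a d (J (M r)))⁻¹ (M r) :=
    fun r hr => by
      obtain ⟨z, hz, hzr⟩ := hex r hr
      rw [← hzr, (hJ z hz).1]; exact (hJ z hz).2
  have hJG : ∀ r ∈ Ioc (0 : ℝ) 1, blissMass p a d (J (M r)) = M r := fun r hr => by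
    obtain ⟨z, hz, hzr⟩ := hex r hr
    rw [← hzr, (hJ z hz).1]
  set e : ℝ → ℝ := fun r => r ^ (a + p - 1) * v r ^ p with he_def
  have hec : Continuous e := (Real.continuous_rpow_const (by linarith)).mul
    (hv.rpow_const fun _ => Or.inr hp0.le)
  -- The first term vanishes at r = 1 and is nonnegative elsewhere, so monotonicity of `W` compares
  -- only energies and potentials.
  set W : ℝ → ℝ := fun r => r ^ (d - (d - a) / p) * u r ^ ((d * (p - 1) + a) / a) *
    J (M r) ^ ((d - a) / p) - youngCoef p a d * (∫ s in r..1, e s) -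
    blissPotential p a d (J (M r)) with hW
  have hk : 1 ≤ (d * (p - 1) + a) / a := by
    rw [le_div_iff₀ ha]; nlinarith
  have hWd : ∀ r ∈ Ioo (0 : ℝ) 1, ∃ W', 0 ≤ W' ∧ HasDerivAt W W' r := fun r hr => by
    have hr' : r ∈ Ioc (0 : ℝ) 1 := ⟨hr.1, hr.2.le⟩
    have hz := hJpos r hr'
    have hyd : HasDerivAt (fun r => J (M r)) ((blissDensity p a d (J (M r)))⁻¹ * f r) r :=
      (hJd r hr').comp r (hMd r hr)
    have d1 : HasDerivAt (fun r : ℝ => r ^ (d - (d - a) / p)) _ r :=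
      Real.hasDerivAt_rpow_const (Or.inl hr.1.ne')
    have d2 := (hu r).rpow_const (p := (d * (p - 1) + a) / a) (Or.inr hk)
    have d3 := hyd.rpow_const (p := (d - a) / p) (Or.inl hz.ne')
    have d4 : HasDerivAt (fun r => ∫ s in r..1, e s) (-e r) r :=
      intervalIntegral.integral_hasDerivAt_left (hec.intervalIntegrable _ _)
        hec.stronglyMeasurable.stronglyMeasurableAtFilter hec.continuousAt
    have d5 := (hasDerivAt_blissPotential hp ha hd hz).comp r hyd
    refine ⟨_, ?_, (((d1.mul d2).mul d3).sub (d4.const_mul (youngCoef p a d))).sub d5⟩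
    refine (calibration_nonneg hp ha hd hr.1 (hupos r hr.2) hz (hpos r)).trans_eq ?_
    have hm := (blissDensity_pos (p := p) (a := a) (d := d) hz).ne'
    simp only [he_def, hf_def, Pi.mul_apply]
    field_simp
    ring
  have hWc : ∀ r ∈ Ioc (0 : ℝ) 1, ContinuousWithinAt W (Ioc 0 1) r := fun r hr => by
    have hz := hJpos r hr
    have hyc : ContinuousWithinAt (fun r => J (M r)) (Ioc 0 1) r :=
      (hJd r hr).continuousAt.comp_continuousWithinAt
        ((hMc r ⟨hr.1.le, hr.2⟩).mono Ioc_subset_Icc_self)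
    have c1 : ContinuousWithinAt (fun r : ℝ => r ^ (d - (d - a) / p)) (Ioc 0 1) r :=
      (Real.continuousAt_rpow_const _ _ (Or.inl hr.1.ne')).continuousWithinAt
    have c2 : ContinuousWithinAt (fun r => u r ^ ((d * (p - 1) + a) / a)) (Ioc 0 1) r :=
      (huc.rpow_const fun _ => Or.inr (by linarith)).continuousWithinAt
    have c3 : ContinuousWithinAt (fun r => J (M r) ^ ((d - a) / p)) (Ioc 0 1) r :=
      hyc.rpow_const (Or.inl hz.ne')
    have c4 : ContinuousWithinAt (fun r => ∫ s in r..1, e s) (Ioc 0 1) r :=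
      HasDerivAt.continuousAt (intervalIntegral.integral_hasDerivAt_left
        (hec.intervalIntegrable _ _) hec.stronglyMeasurable.stronglyMeasurableAtFilter
        hec.continuousAt) |>.continuousWithinAt
    have c5 : ContinuousWithinAt (fun r => blissPotential p a d (J (M r))) (Ioc 0 1) r :=
      ContinuousAt.comp_continuousWithinAt (f := fun r => J (M r))
        (hasDerivAt_blissPotential hp ha hd hz).continuousAt hyc
    exact ((((c1.mul c2).mul c3).sub (c4.const_mul _))).sub c5
  have hWmono : MonotoneOn W (Ioc 0 1) := by
    refine monotoneOn_of_deriv_nonneg (convex_Ioc 0 1) hWc (fun r hr => ?_) fun r hr => ?_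
    · rw [interior_Ioc] at hr
      obtain ⟨W', _, h⟩ := hWd r hr
      exact h.differentiableAt.differentiableWithinAt
    · rw [interior_Ioc] at hr
      obtain ⟨W', h0, h⟩ := hWd r hr
      rw [h.deriv]; exact h0
  have hW1 : W 1 = -blissPotential p a d y := by
    simp only [hW]
    rw [hu1, Real.zero_rpow (by linarith), intervalIntegral.integral_same, hM1, (hJ y hy).1]
    ring
  -- `W` is not evaluated at 0, where `J` has no prescribed value. It is evaluated at a small δ with
  -- J (M δ) ≤ ε.
  have hbound : ∀ ε, 0 < ε → blissPotential p a d y ≤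
      blissPotential p a d ε + youngCoef p a d * ∫ r in (0 : ℝ)..1, e r := fun ε hε => by
    have hMt : Tendsto M (𝓝[>] 0) (𝓝 0) := by
      have := (hMc 0 (left_mem_Icc.2 zero_le_one)).tendsto
      rw [hM0] at this
      refine this.mono_left (nhdsWithin_le_of_mem ?_)
      exact mem_of_superset (Ioc_mem_nhdsGT zero_lt_one) Ioc_subset_Icc_self
    obtain ⟨δ, hδM, hδ⟩ := ((hMt.eventually_lt_const (blissMass_pos hp ha hd hε)).and
      (Ioc_mem_nhdsGT (zero_lt_one' ℝ))).exists
    have hJδ : J (M δ) ≤ ε := by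
      have h := (strictMonoOn_blissMass hp ha hd).lt_iff_lt (hJpos δ hδ).le hε.le
      rw [hJG δ hδ] at h
      exact (h.1 hδM).le
    have h1 := hWmono hδ (right_mem_Ioc.2 zero_lt_one) hδ.2
    rw [hW1] at h1
    have h2 := monotoneOn_blissPotential hp ha hd (hJpos δ hδ) hε hJδ
    have h3 : 0 ≤ δ ^ (d - (d - a) / p) * u δ ^ ((d * (p - 1) + a) / a) *
        J (M δ) ^ ((d - a) / p) := by
      have h4 : 0 ≤ u δ := by
        rcases hδ.2.lt_or_eq with h | h
        · exact (hupos δ h).le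
        · rw [h, hu1]
      have := hJpos δ hδ
      have := hδ.1
      positivity
    have h5 : ∫ s in δ..1, e s ≤ ∫ s in (0 : ℝ)..1, e s := by
      refine intervalIntegral.integral_mono_interval hδ.1.le hδ.2 le_rfl ?_
        (hec.intervalIntegrable _ _)
      filter_upwards [ae_restrict_mem measurableSet_Ioc] with r hr
      exact mul_nonneg (Real.rpow_nonneg hr.1.le _) (Real.rpow_nonneg (hpos r).le _)
    have h6 := mul_le_mul_of_nonneg_left h5 hA
    simp only [hW] at h1
    linarith
  have hlim : Tendsto (fun ε => blissPotential p a d ε + youngCoef p a d *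
      ∫ r in (0 : ℝ)..1, e r) (𝓝[>] 0)
      (𝓝 (0 + youngCoef p a d * ∫ r in (0 : ℝ)..1, e r)) := by
    refine Tendsto.add_const _ ?_
    have := (continuousOn_blissPotential hp ha hd zero_le_one 0
      (left_mem_Icc.2 zero_le_one)).tendsto
    rw [blissPotential_zero ha hd] at this
    refine this.mono_left (nhdsWithin_le_of_mem ?_)
    exact mem_of_superset (Ioc_mem_nhdsGT zero_lt_one) Ioc_subset_Icc_self
  rw [zero_add] at hlim
  exact ge_of_tendsto hlim (by filter_upwards [self_mem_nhdsWithin] with ε hε using hbound ε hε)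

/-- The sharp inequality compared with the Bliss profile on `(0, y)`. -/
lemma moment_mul_mass_le {p a d y : ℝ} (hp : 1 < p) (ha : 0 < a) (hd : a < d)
    {v : ℝ → ℝ} (hv : Continuous v) (hpos : ∀ x, 0 < v x) (hy : 0 < y) :
    (a / (p - 1)) ^ p * blissMoment p a d y *
      (∫ r in (0 : ℝ)..1, r ^ (d - 1) * (∫ s in r..1, v s) ^ (d * p / a)) ^ (a / d) ≤
    (∫ r in (0 : ℝ)..1, r ^ (a + p - 1) * v r ^ p) * blissMass p a d y ^ (a / d) := by
  have hd0 : 0 < d := ha.trans hd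
  have hda : 0 < d - a := sub_pos.2 hd
  have hp0 : 0 < p := by linarith
  have hp1 : 0 < p - 1 := by linarith
  have hq : 0 < d * p / a := by positivity
  have huc : Continuous fun r => ∫ s in r..1, v s :=
    continuous_iff_continuousAt.2 fun r => (intervalIntegral.integral_hasDerivAt_left
      (hv.intervalIntegrable _ _) hv.stronglyMeasurable.stronglyMeasurableAtFilter
      hv.continuousAt).continuousAt
  set N := ∫ r in (0 : ℝ)..1, r ^ (d - 1) * (∫ s in r..1, v s) ^ (d * p / a) with hN
  set E := ∫ r in (0 : ℝ)..1, r ^ (a + p - 1) * v r ^ p with hE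
  have hNpos : 0 < N := by
    refine intervalIntegral.intervalIntegral_pos_of_pos_on
      ((intervalIntegral.intervalIntegrable_rpow' (by linarith)).mul_continuousOn
      (huc.rpow_const fun _ => Or.inr hq.le).continuousOn) (fun r hr => ?_) zero_lt_one
    exact mul_pos (Real.rpow_pos_of_pos hr.1 _) (Real.rpow_pos_of_pos
      (intervalIntegral.intervalIntegral_pos_of_pos (hv.intervalIntegrable _ _) hpos hr.2) _)
  have hG := blissMass_pos hp ha hd hy
  -- The mass is homogeneous of degree q = dp/a in v, so this factor gives t v exactly the mass of
  -- the profile on (0, y).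
  set t := (blissMass p a d y / N) ^ (a / (d * p)) with ht
  have htpos : 0 < t := by positivity
  have h := blissPotential_le_energy hp ha hd (v := fun x => t * v x) (by fun_prop)
    (fun x => mul_pos htpos (hpos x)) hy (by
      have e : ∀ r ∈ uIcc (0 : ℝ) 1, r ^ (d - 1) * (∫ s in r..1, t * v s) ^ (d * p / a) =
          blissMass p a d y / N * (r ^ (d - 1) * (∫ s in r..1, v s) ^ (d * p / a)) := by
        intro r hr
        rw [uIcc_of_le zero_le_one] at hr
        rw [intervalIntegral.integral_const_mul, Real.mul_rpow htpos.le
          (intervalIntegral.integral_nonneg hr.2 fun s _ => (hpos s).le), ht, ← Real.rpow_mul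
          (by positivity)]
        have : a / (d * p) * (d * p / a) = 1 := by field_simp
        rw [this, Real.rpow_one]; ring
      rw [intervalIntegral.integral_congr e, intervalIntegral.integral_const_mul, ← hN]
      field_simp)
  have e2 : ∫ r in (0 : ℝ)..1, r ^ (a + p - 1) * (t * v r) ^ p =
      (blissMass p a d y / N) ^ (a / d) * E := by
    rw [hE, ← intervalIntegral.integral_const_mul]
    congr 1; ext r
    rw [Real.mul_rpow htpos.le (hpos r).le, ht, ← Real.rpow_mul (by positivity)]
    have : a / (d * p) * p = a / d := by field_simp
    rw [this]; ring
  rw [e2, Real.div_rpow hG.le hNpos.le] at h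
  have h' := (blissPotential_ge (p := p) (a := a) (d := d) hy.le).trans h
  have hh : 0 < a / (p - 1) := by positivity
  have hNr : 0 < N ^ (a / d) := by positivity
  have hk : 0 < (d * (p - 1) + a) / (a * p) := by positivity
  -- The coefficient of the moment in the potential is the Young coefficient times (a/(p-1))^p,
  -- which turns the moment into the energy of the profile.
  have e3 : youngCoef p a d * (a / (p - 1)) ^ p = (d * (p - 1) + a) / (p * (p - 1)) := by
    rw [youngCoef, mul_assoc, ← Real.rpow_add hh]
    have : -(p - 1) + p = 1 := by ring
    rw [this, Real.rpow_one]
    field_simp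
  have hA : 0 < youngCoef p a d := by unfold youngCoef; positivity
  rw [← e3, mul_assoc] at h'
  have h'' := le_of_mul_le_mul_left h' hA
  calc _ ≤ blissMass p a d y ^ (a / d) / N ^ (a / d) * E * N ^ (a / d) := by gcongr
    _ = _ := by field_simp

/-! ### Integrability on the half-line and the sharp constant. -/

lemma one_add_rpow_neg_le {b f t : ℝ} (hf : 0 ≤ f) (ht : 0 < t) :
    (1 + t ^ b) ^ (-f) ≤ t ^ (-(b * f)) := by
  have h0 : 0 < t ^ b := Real.rpow_pos_of_pos ht _
  calc (1 + t ^ b) ^ (-f) ≤ (t ^ b) ^ (-f) :=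
        Real.rpow_le_rpow_of_nonpos h0 (by linarith) (by linarith)
    _ = t ^ (-(b * f)) := by rw [← Real.rpow_mul ht.le]; ring_nf

lemma one_add_rpow_neg_le_one {b f t : ℝ} (hf : 0 ≤ f) (ht : 0 ≤ t) :
    (1 + t ^ b) ^ (-f) ≤ 1 :=
  Real.rpow_le_one_of_one_le_of_nonpos (by linarith [Real.rpow_nonneg ht b]) (by linarith)

lemma integrableOn_rpow_mul_one_add {e b f : ℝ} (he : -1 < e) (hf : 0 ≤ f)
    (h : e - b * f < -1) :
    IntegrableOn (fun t : ℝ => t ^ e * (1 + t ^ b) ^ (-f)) (Ioi 0) := by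
  rw [← Ioc_union_Ioi_eq_Ioi zero_le_one]
  have hm : Measurable fun t : ℝ => t ^ e * (1 + t ^ b) ^ (-f) := by fun_prop
  refine IntegrableOn.union ?_ ?_
  · refine Integrable.mono' (g := fun t => t ^ e) ?_ hm.aestronglyMeasurable ?_
    · exact (intervalIntegrable_iff_integrableOn_Ioc_of_le zero_le_one).1
        (intervalIntegral.intervalIntegrable_rpow' he)
    · filter_upwards [ae_restrict_mem measurableSet_Ioc] with t ht
      have h0 := Real.rpow_nonneg ht.1.le e
      have h1 := one_add_rpow_neg_le_one (b := b) hf ht.1.le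
      have h2 : 0 < t := ht.1
      rw [Real.norm_of_nonneg (by positivity)]
      exact mul_le_of_le_one_right h0 h1
  · refine Integrable.mono' (integrableOn_Ioi_rpow_of_lt h zero_lt_one)
      hm.aestronglyMeasurable ?_
    filter_upwards [ae_restrict_mem measurableSet_Ioi] with t ht
    have ht0 : 0 < t := zero_lt_one.trans ht
    rw [Real.norm_of_nonneg (by positivity), sub_eq_add_neg, Real.rpow_add ht0]
    have := one_add_rpow_neg_le (b := b) hf ht0
    gcongr

lemma integrableOn_blissDensity {p a d : ℝ} (hp : 1 < p) (ha : 0 < a) (hd : a < d) :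
    IntegrableOn (blissDensity p a d) (Ioi 0) := by
  have hda : 0 < d - a := sub_pos.2 hd
  have hp1 : 0 < p - 1 := by linarith
  have hd0 : 0 < d := by linarith
  refine integrableOn_rpow_mul_one_add (by linarith) (by positivity) ?_
  have e : d - 1 - (d - a) / (p - 1) * (d * p / (d - a)) = -1 - d / (p - 1) := by
    field_simp; ring
  have : 0 < d / (p - 1) := by positivity
  rw [e]; linarith

lemma integrableOn_blissMoment {p a d : ℝ} (hp : 1 < p) (ha : 0 < a) (hd : a < d) :
    IntegrableOn (fun t => t ^ ((d - a) / (p - 1)) * blissDensity p a d t) (Ioi 0) := by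
  have hda : 0 < d - a := sub_pos.2 hd
  have hp1 : 0 < p - 1 := by linarith
  have hd0 : 0 < d := by linarith
  have h := integrableOn_rpow_mul_one_add (e := (d - a) / (p - 1) + (d - 1))
    (b := (d - a) / (p - 1)) (f := d * p / (d - a))
    (by have : 0 < (d - a) / (p - 1) := by positivity
        linarith) (by positivity) (by
      have e : (d - a) / (p - 1) + (d - 1) - (d - a) / (p - 1) * (d * p / (d - a)) =
          -1 - a / (p - 1) := by
        field_simp; ring
      have : 0 < a / (p - 1) := by positivity
      rw [e]; linarith)
  refine h.congr_fun (fun t ht => ?_) measurableSet_Ioi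
  simp only [blissDensity]
  rw [Real.rpow_add ht]; ring

/-- The mass of the Bliss profile on `(0, ∞)`. -/
noncomputable def totalMass (p a d : ℝ) : ℝ := ∫ t in Ioi (0 : ℝ), blissDensity p a d t

/-- The energy of the Bliss profile on `(0, ∞)`. -/
noncomputable def totalEnergy (p a d : ℝ) : ℝ :=
  (a / (p - 1)) ^ p * ∫ t in Ioi (0 : ℝ), t ^ ((d - a) / (p - 1)) * blissDensity p a d t

/-- The sharp constant in Bliss' inequality. -/
noncomputable def blissConst (p a d : ℝ) : ℝ := totalMass p a d * totalEnergy p a d ^ (-(d / a))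

lemma totalMass_pos {p a d : ℝ} (hp : 1 < p) (ha : 0 < a) (hd : a < d) :
    0 < totalMass p a d := by
  refine (integral_pos_iff_support_of_nonneg_ae ?_ (integrableOn_blissDensity hp ha hd)).2 ?_
  · filter_upwards [ae_restrict_mem measurableSet_Ioi] with t ht using (blissDensity_pos ht).le
  · rw [Measure.restrict_apply' measurableSet_Ioi, inter_eq_right.2]
    · simp
    · exact fun t ht => (blissDensity_pos ht).ne'

lemma totalEnergy_pos {p a d : ℝ} (hp : 1 < p) (ha : 0 < a) (hd : a < d) :
    0 < totalEnergy p a d := by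
  have hp1 : 0 < p - 1 := by linarith
  refine mul_pos (by positivity) ?_
  have hpos : ∀ t ∈ Ioi (0 : ℝ), 0 < t ^ ((d - a) / (p - 1)) * blissDensity p a d t :=
    fun t ht => mul_pos (Real.rpow_pos_of_pos ht _) (blissDensity_pos ht)
  refine (integral_pos_iff_support_of_nonneg_ae ?_ (integrableOn_blissMoment hp ha hd)).2 ?_
  · filter_upwards [ae_restrict_mem measurableSet_Ioi] with t ht using (hpos t ht).le
  · rw [Measure.restrict_apply' measurableSet_Ioi, inter_eq_right.2]
    · simp
    · exact fun t ht => (hpos t ht).ne'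

/-- Let y → ∞ in `moment_mul_mass_le` and raise the result to the power d/a. -/
lemma integral_le_blissConst {p a d : ℝ} (hp : 1 < p) (ha : 0 < a) (hd : a < d)
    {v : ℝ → ℝ} (hv : Continuous v) (hpos : ∀ x, 0 < v x) :
    ∫ r in (0 : ℝ)..1, r ^ (d - 1) * (∫ s in r..1, v s) ^ (d * p / a) ≤
    blissConst p a d * (∫ r in (0 : ℝ)..1, r ^ (a + p - 1) * v r ^ p) ^ (d / a) := by
  have hd0 : 0 < d := ha.trans hd
  have hT := totalEnergy_pos hp ha hd
  have hG := totalMass_pos hp ha hd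
  set N := ∫ r in (0 : ℝ)..1, r ^ (d - 1) * (∫ s in r..1, v s) ^ (d * p / a)
  set E := ∫ r in (0 : ℝ)..1, r ^ (a + p - 1) * v r ^ p
  have hE : 0 ≤ E := intervalIntegral.integral_nonneg zero_le_one fun r hr =>
    mul_nonneg (Real.rpow_nonneg hr.1 _) (Real.rpow_nonneg (hpos r).le _)
  have hN : 0 ≤ N := intervalIntegral.integral_nonneg zero_le_one fun r hr =>
    mul_nonneg (Real.rpow_nonneg hr.1 _) (Real.rpow_nonneg
      (intervalIntegral.integral_nonneg hr.2 fun s _ => (hpos s).le) _)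
  have t1 : Tendsto (blissMass p a d) atTop (𝓝 (totalMass p a d)) :=
    intervalIntegral_tendsto_integral_Ioi 0 (integrableOn_blissDensity hp ha hd) tendsto_id
  have t2 : Tendsto (fun y => (a / (p - 1)) ^ p * blissMoment p a d y) atTop
      (𝓝 (totalEnergy p a d)) :=
    (intervalIntegral_tendsto_integral_Ioi 0 (integrableOn_blissMoment hp ha hd)
      tendsto_id).const_mul _
  have hmain : totalEnergy p a d * N ^ (a / d) ≤ E * totalMass p a d ^ (a / d) :=
    le_of_tendsto_of_tendsto (t2.mul_const _)
      ((t1.rpow_const (Or.inl hG.ne')).const_mul E)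
      (by filter_upwards [eventually_gt_atTop 0] with y hy
            using moment_mul_mass_le hp ha hd hv hpos hy)
  have h1 : N ^ (a / d) ≤ E / totalEnergy p a d * totalMass p a d ^ (a / d) := by
    rw [div_mul_eq_mul_div, le_div_iff₀ hT]; linarith
  have h2 := Real.rpow_le_rpow (by positivity) h1 (show 0 ≤ d / a by positivity)
  have h3 : a / d * (d / a) = 1 := by field_simp
  rw [← Real.rpow_mul hN, Real.mul_rpow (by positivity) (by positivity), ← Real.rpow_mul hG.le,
    h3, Real.rpow_one, Real.rpow_one, Real.div_rpow hE hT.le] at h2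
  refine h2.trans_eq ?_
  rw [blissConst, Real.rpow_neg hT.le]
  field_simp

/-! ### Bliss' inequality for general `v` and the upper bound for Σ_p. -/

lemma lintegral_enorm_eq_ofReal {v : ℝ → ℝ} (hv : Continuous v) (hpos : ∀ x, 0 < v x) {r : ℝ}
    (hr : r ≤ 1) : ∫⁻ s in Ioo r 1, ‖v s‖ₑ = ENNReal.ofReal (∫ s in r..1, v s) := by
  rw [intervalIntegral.integral_of_le hr, integral_Ioc_eq_integral_Ioo,
    ofReal_integral_eq_lintegral_ofReal]
  · exact lintegral_congr fun s => Real.enorm_of_nonneg (hpos s).le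
  · exact (hv.integrableOn_Icc).mono_set Ioo_subset_Icc_self
  · exact Eventually.of_forall fun s => (hpos s).le

lemma bliss_of_continuous {p a d : ℝ} (hp : 1 < p) (ha : 0 < a) (hd : a < d)
    {v : ℝ → ℝ} (hv : Continuous v) (hpos : ∀ x, 0 < v x) :
    ∫⁻ r in Ioo (0 : ℝ) 1, ENNReal.ofReal (r ^ (d - 1)) *
      (∫⁻ s in Ioo r 1, ‖v s‖ₑ) ^ (d * p / a) ≤
    ENNReal.ofReal (blissConst p a d) * wNorm p (a + p - 1) v ^ (d * p / a) := by
  have hd0 : 0 < d := ha.trans hd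
  have hp0 : 0 < p := by linarith
  have hq : 0 < d * p / a := by positivity
  have huc : Continuous fun r => ∫ s in r..1, v s :=
    continuous_iff_continuousAt.2 fun r => (intervalIntegral.integral_hasDerivAt_left
      (hv.intervalIntegrable _ _) hv.stronglyMeasurable.stronglyMeasurableAtFilter
      hv.continuousAt).continuousAt
  have hu0 : ∀ r ∈ Ioo (0 : ℝ) 1, 0 ≤ ∫ s in r..1, v s := fun r hr =>
    intervalIntegral.integral_nonneg hr.2.le fun s _ => (hpos s).le
  have e1 : ∫⁻ r in Ioo (0 : ℝ) 1, ENNReal.ofReal (r ^ (d - 1)) *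
      (∫⁻ s in Ioo r 1, ‖v s‖ₑ) ^ (d * p / a) =
      ENNReal.ofReal (∫ r in (0 : ℝ)..1, r ^ (d - 1) * (∫ s in r..1, v s) ^ (d * p / a)) := by
    rw [intervalIntegral.integral_of_le zero_le_one, integral_Ioc_eq_integral_Ioo,
      ofReal_integral_eq_lintegral_ofReal]
    · refine setLIntegral_congr_fun measurableSet_Ioo fun r hr => ?_
      rw [lintegral_enorm_eq_ofReal hv hpos hr.2.le, ENNReal.ofReal_rpow_of_nonneg (hu0 r hr) hq.le,
        ENNReal.ofReal_mul (Real.rpow_nonneg hr.1.le _)]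
    · exact ((intervalIntegrable_iff_integrableOn_Ioo_of_le zero_le_one).1
        ((intervalIntegral.intervalIntegrable_rpow' (by linarith)).mul_continuousOn
        (huc.rpow_const fun _ => Or.inr hq.le).continuousOn))
    · filter_upwards [ae_restrict_mem measurableSet_Ioo] with r hr
      exact mul_nonneg (Real.rpow_nonneg hr.1.le _) (Real.rpow_nonneg (hu0 r hr) _)
  have hE : 0 ≤ ∫ r in (0 : ℝ)..1, r ^ (a + p - 1) * v r ^ p :=
    intervalIntegral.integral_nonneg zero_le_one fun r hr =>
      mul_nonneg (Real.rpow_nonneg hr.1 _) (Real.rpow_nonneg (hpos r).le _)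
  have e2 : wNorm p (a + p - 1) v ^ p =
      ENNReal.ofReal (∫ r in (0 : ℝ)..1, r ^ (a + p - 1) * v r ^ p) := by
    rw [wNorm_rpow hp0, intervalIntegral.integral_of_le zero_le_one, integral_Ioc_eq_integral_Ioo,
      ofReal_integral_eq_lintegral_ofReal]
    · refine setLIntegral_congr_fun measurableSet_Ioo fun r hr => ?_
      rw [Real.enorm_of_nonneg (hpos r).le, ENNReal.ofReal_rpow_of_nonneg (hpos r).le hp0.le,
        ENNReal.ofReal_mul (Real.rpow_nonneg hr.1.le _)]
    · exact ((Real.continuous_rpow_const (by linarith)).mul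
        (hv.rpow_const fun _ => Or.inr hp0.le)).integrableOn_Icc.mono_set Ioo_subset_Icc_self
    · filter_upwards [ae_restrict_mem measurableSet_Ioo] with r hr
      exact mul_nonneg (Real.rpow_nonneg hr.1.le _) (Real.rpow_nonneg (hpos r).le _)
  have e3 : wNorm p (a + p - 1) v ^ (d * p / a) = (wNorm p (a + p - 1) v ^ p) ^ (d / a) := by
    rw [← ENNReal.rpow_mul]; congr 1; field_simp
  have hC : 0 ≤ blissConst p a d := by
    have := totalMass_pos hp ha hd
    have := totalEnergy_pos hp ha hd
    unfold blissConst; positivity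
  rw [e1, e3, e2, ENNReal.ofReal_rpow_of_nonneg hE (by positivity), ← ENNReal.ofReal_mul hC]
  exact ENNReal.ofReal_le_ofReal (integral_le_blissConst hp ha hd hv hpos)

lemma isFiniteMeasure_weight {a : ℝ} (ha : -1 < a) : IsFiniteMeasure (weight a) := by
  refine isFiniteMeasure_withDensity_ofReal ?_
  exact ((intervalIntegrable_iff_integrableOn_Ioo_of_le zero_le_one).1
    (intervalIntegral.intervalIntegrable_rpow' ha)).2

/-- Bliss' inequality with the sharp constant. -/
theorem bliss_inequality {p a d : ℝ} (hp : 1 < p) (ha : 0 < a) (hd : a < d)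
    {v : ℝ → ℝ} (hv : MemLpW p (a + p - 1) v) :
    ∫⁻ r in Ioo (0 : ℝ) 1, ENNReal.ofReal (r ^ (d - 1)) *
      (∫⁻ s in Ioo r 1, ‖v s‖ₑ) ^ (d * p / a) ≤
    ENNReal.ofReal (blissConst p a d) * wNorm p (a + p - 1) v ^ (d * p / a) := by
  have hd0 : 0 < d := ha.trans hd
  have hp0 : 0 < p := by linarith
  have hq : 0 < d * p / a := by positivity
  have hp1 : 1 ≤ ENNReal.ofReal p := by simpa using hp.le
  have := isFiniteMeasure_weight (a := a + p - 1) (by linarith)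
  set ε : ℕ → ℝ := fun n => 1 / ((n : ℝ) + 1) with hε
  have hεpos : ∀ n, 0 < ε n := fun n => by positivity
  have hεt : Tendsto (fun n => ENNReal.ofReal (ε n)) atTop (𝓝 0) := by
    simpa only [ENNReal.ofReal_zero] using
      ENNReal.tendsto_ofReal (tendsto_one_div_add_atTop_nhds_zero_nat (𝕜 := ℝ))
  choose f hfs hfe hfc hfL using fun n => MemLp.exists_hasCompactSupport_eLpNorm_sub_le
    ENNReal.ofReal_ne_top hv (ε := ENNReal.ofReal (ε n)) (by simpa using hεpos n)
  -- Adding ε to |f| makes the approximant strictly positive, at a cost in norm that tends to 0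
  -- because the weight is finite.
  set w : ℕ → ℝ → ℝ := fun n s => |f n s| + ε n with hw
  have hwc : ∀ n, Continuous (w n) := fun n => (hfc n).abs.add continuous_const
  have hwpos : ∀ n x, 0 < w n x := fun n x =>
    add_pos_of_nonneg_of_pos (abs_nonneg _) (hεpos n)
  set W1 := wNorm p (a + p - 1) (fun _ => 1)
  have hW1 : W1 ≠ ⊤ := (memLp_const (1 : ℝ)).2.ne
  have hwn : ∀ n, wNorm p (a + p - 1) (w n) ≤
      wNorm p (a + p - 1) v + ENNReal.ofReal (ε n) + ENNReal.ofReal (ε n) * W1 := fun n => by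
    have h1 : wNorm p (a + p - 1) (w n) ≤
        wNorm p (a + p - 1) (f n) + wNorm p (a + p - 1) (fun _ => ε n) := by
      have := eLpNorm_add_le (μ := weight (a + p - 1)) (f := fun s => |f n s|) (g := fun _ => ε n)
        (hfc n).abs.aestronglyMeasurable aestronglyMeasurable_const hp1
      refine this.trans (add_le_add_left (le_of_eq ?_) _)
      exact eLpNorm_norm (f n)
    have h2 : wNorm p (a + p - 1) (f n) ≤ wNorm p (a + p - 1) v + ENNReal.ofReal (ε n) := by
      have e : f n = v - (v - f n) := by simp
      calc wNorm p (a + p - 1) (f n) = wNorm p (a + p - 1) (v - (v - f n)) := by rw [← e]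
        _ ≤ _ := (eLpNorm_sub_le hv.1 (hv.1.sub (hfL n).1) hp1).trans
          (add_le_add_right (hfe n) _)
    have h3 : wNorm p (a + p - 1) (fun _ => ε n) = ENNReal.ofReal (ε n) * W1 := by
      have := eLpNorm_const_smul (ε n) (fun _ : ℝ => (1 : ℝ)) (ENNReal.ofReal p)
        (weight (a + p - 1))
      rw [Real.enorm_of_nonneg (hεpos n).le] at this
      refine Eq.trans ?_ this
      unfold wNorm
      congr 1; ext; simp
    exact h1.trans (by rw [h3]; gcongr)
  have hvm := hv.aemeasurable
  have hfatou : ∀ r ∈ Ioo (0 : ℝ) 1, ENNReal.ofReal (r ^ (d - 1)) *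
      (∫⁻ s in Ioo r 1, ‖v s‖ₑ) ^ (d * p / a) ≤ liminf (fun n => ENNReal.ofReal (r ^ (d - 1)) *
      (∫⁻ s in Ioo r 1, ‖w n s‖ₑ) ^ (d * p / a)) atTop := fun r hr => by
    set C := ENNReal.ofReal (r ^ (-((a + p - 1) / p)))
    set U := ∫⁻ s in Ioo r 1, ‖v s‖ₑ with hU
    -- Since w n ≥ |f n|, Hölder's inequality on (r, 1) gives this one-sided bound, and Fatou's
    -- lemma needs no more.
    have hUle : ∀ n, U - C * ENNReal.ofReal (ε n) ≤ ∫⁻ s in Ioo r 1, ‖w n s‖ₑ := fun n => by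
      rw [tsub_le_iff_right]
      have hH := (lintegral_enorm_le hp (show 0 ≤ a + p - 1 by linarith) (f := v - f n)
        (hvm.sub (hfc n).aemeasurable) hr).trans (mul_le_mul_right (hfe n) _)
      refine le_trans ?_ (add_le_add_right hH _)
      rw [← lintegral_add_left (hwc n).measurable.enorm]
      refine lintegral_mono fun s => ?_
      have h1 : ‖v s‖ₑ ≤ ‖f n s‖ₑ + ‖(v - f n) s‖ₑ := by
        have : v s = f n s + (v - f n) s := by simp
        calc ‖v s‖ₑ = ‖f n s + (v - f n) s‖ₑ := by rw [← this]
          _ ≤ _ := enorm_add_le _ _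
      refine h1.trans (add_le_add_left ?_ _)
      rw [Real.enorm_eq_ofReal_abs, Real.enorm_of_nonneg (hwpos n s).le]
      exact ENNReal.ofReal_le_ofReal (by simp only [hw]; linarith [hεpos n])
    have ht0 : Tendsto (fun n => C * ENNReal.ofReal (ε n)) atTop (𝓝 0) := by
      simpa using ENNReal.Tendsto.const_mul (a := C) hεt (Or.inr ENNReal.ofReal_ne_top)
    have ht1 : Tendsto (fun n => U - C * ENNReal.ofReal (ε n)) atTop (𝓝 U) := by
      simpa using ENNReal.Tendsto.sub (tendsto_const_nhds (x := U)) ht0 (Or.inr ENNReal.zero_ne_top)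
    have ht2 : Tendsto (fun n => ENNReal.ofReal (r ^ (d - 1)) *
        (U - C * ENNReal.ofReal (ε n)) ^ (d * p / a)) atTop
        (𝓝 (ENNReal.ofReal (r ^ (d - 1)) * U ^ (d * p / a))) :=
      ENNReal.Tendsto.const_mul ((ENNReal.continuous_rpow_const.tendsto _).comp ht1)
        (Or.inr ENNReal.ofReal_ne_top)
    rw [← ht2.liminf_eq]
    refine liminf_le_liminf (Eventually.of_forall fun n => ?_)
    exact mul_le_mul_right (ENNReal.rpow_le_rpow (hUle n) hq.le) _
  have hmeas : ∀ n, Measurable fun r : ℝ => ENNReal.ofReal (r ^ (d - 1)) *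
      (∫⁻ s in Ioo r 1, ‖w n s‖ₑ) ^ (d * p / a) := fun n => by
    have : Antitone fun r : ℝ => ∫⁻ s in Ioo r 1, ‖w n s‖ₑ := fun r r' h =>
      lintegral_mono_set (Ioo_subset_Ioo_left h)
    exact (by fun_prop : Measurable fun r : ℝ => ENNReal.ofReal (r ^ (d - 1))).mul
      (this.measurable.pow_const _)
  have hlim : Tendsto (fun n => ENNReal.ofReal (blissConst p a d) *
      (wNorm p (a + p - 1) v + ENNReal.ofReal (ε n) + ENNReal.ofReal (ε n) * W1) ^ (d * p / a))
      atTop (𝓝 (ENNReal.ofReal (blissConst p a d) *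
      (wNorm p (a + p - 1) v + 0 + 0 * W1) ^ (d * p / a))) :=
    ENNReal.Tendsto.const_mul ((ENNReal.continuous_rpow_const.tendsto _).comp
      ((tendsto_const_nhds.add hεt).add (ENNReal.Tendsto.mul_const hεt (Or.inr hW1))))
      (Or.inr ENNReal.ofReal_ne_top)
  rw [zero_mul, add_zero, add_zero] at hlim
  calc _ ≤ ∫⁻ r in Ioo (0 : ℝ) 1, liminf (fun n => ENNReal.ofReal (r ^ (d - 1)) *
      (∫⁻ s in Ioo r 1, ‖w n s‖ₑ) ^ (d * p / a)) atTop :=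
        setLIntegral_mono_ae' measurableSet_Ioo (Eventually.of_forall hfatou)
    _ ≤ liminf (fun n => ∫⁻ r in Ioo (0 : ℝ) 1, ENNReal.ofReal (r ^ (d - 1)) *
      (∫⁻ s in Ioo r 1, ‖w n s‖ₑ) ^ (d * p / a)) atTop := lintegral_liminf_le hmeas
    _ ≤ liminf (fun n => ENNReal.ofReal (blissConst p a d) *
      (wNorm p (a + p - 1) v + ENNReal.ofReal (ε n) + ENNReal.ofReal (ε n) * W1) ^
        (d * p / a)) atTop := by
      refine liminf_le_liminf (Eventually.of_forall fun n => ?_)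
      refine (bliss_of_continuous hp ha hd (hwc n) (hwpos n)).trans ?_
      have := hwn n
      gcongr
    _ = _ := hlim.liminf_eq

lemma sobolevSup_le_blissConst {p α₀ α₁ θ : ℝ} (hp : 1 < p) (hα₁ : 0 < α₁ - p + 1)
    (hθ : α₁ - p < θ) :
    sobolevSup p α₀ α₁ θ ≤ ENNReal.ofReal (blissConst p (α₁ - p + 1) (θ + 1)) := by
  have hp0 : 0 < p := by linarith
  have hq : 0 ≤ critExp p α₁ θ := by
    have : 0 < θ + 1 := by linarith
    unfold critExp; positivity
  refine iSup_le fun u => iSup_le fun v => iSup_le fun hX => iSup_le fun hv => ?_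
  have e1 : α₁ - p + 1 + p - 1 = α₁ := by ring
  have e2 : θ + 1 - 1 = θ := by ring
  have h := bliss_inequality (a := α₁ - p + 1) (d := θ + 1) hp hα₁ (by linarith) (v := v)
    (by rw [e1]; exact hX.2.1)
  rw [e1, e2, hv, ENNReal.one_rpow, mul_one] at h
  refine le_trans (lintegral_mono_ae ?_) h
  filter_upwards [hX.ae_enorm_le hp (by linarith), ae_restrict_mem measurableSet_Ioo] with r hr hr1
  rw [ENNReal.ofReal_mul (Real.rpow_nonneg hr1.1.le _),
    ← ENNReal.ofReal_rpow_of_nonneg (abs_nonneg _) hq, ← Real.enorm_eq_ofReal_abs]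
  have := ENNReal.rpow_le_rpow hr hq
  unfold critExp at this ⊢
  gcongr

/-! ### Truncated Bliss profiles as test functions. -/

/-- The Bliss profile, the extremal of the inequality on `(0, ∞)`. -/
noncomputable def blissProfile (p a d t : ℝ) : ℝ :=
  (1 + t ^ ((d - a) / (p - 1))) ^ (-(a / (d - a)))

noncomputable def blissEnergy (p a d y : ℝ) : ℝ := (a / (p - 1)) ^ p * blissMoment p a d y

/-- The rescaled and truncated Bliss profile, normalized in energy. -/
noncomputable def testFun (p a d R r : ℝ) : ℝ :=
  R ^ (a / p) * blissEnergy p a d R ^ (-(1 / p)) *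
    (blissProfile p a d (R * r) - blissProfile p a d R)

lemma blissProfile_pos {p a d t : ℝ} (ht : 0 ≤ t) : 0 < blissProfile p a d t := by
  unfold blissProfile; positivity

lemma blissProfile_le_one {p a d t : ℝ} (ha : 0 < a) (hd : a < d) (ht : 0 ≤ t) :
    blissProfile p a d t ≤ 1 := by
  have : 0 < d - a := sub_pos.2 hd
  exact one_add_rpow_neg_le_one (by positivity) ht

lemma blissProfile_le_of_le {p a d s t : ℝ} (hp : 1 < p) (ha : 0 < a) (hd : a < d) (hs : 0 ≤ s)
    (hst : s ≤ t) : blissProfile p a d t ≤ blissProfile p a d s := by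
  have h1 : 0 < d - a := sub_pos.2 hd
  have h2 : 0 ≤ (d - a) / (p - 1) := div_nonneg h1.le (by linarith)
  refine Real.rpow_le_rpow_of_nonpos (by positivity) (by gcongr) ?_
  rw [neg_nonpos]; positivity

lemma blissProfile_le_rpow {p a d t : ℝ} (hp : 1 < p) (ha : 0 < a) (hd : a < d) (ht : 0 < t) :
    blissProfile p a d t ≤ t ^ (-(a / (p - 1))) := by
  have h1 : 0 < d - a := sub_pos.2 hd
  have h2 : p - 1 ≠ 0 := by linarith
  have e : (d - a) / (p - 1) * (a / (d - a)) = a / (p - 1) := by field_simp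
  rw [← e]
  exact one_add_rpow_neg_le (by positivity) ht

lemma le_blissProfile {p a d t : ℝ} (hp : 1 < p) (ha : 0 < a) (hd : a < d) (ht : 1 ≤ t) :
    2 ^ (-(a / (d - a))) * t ^ (-(a / (p - 1))) ≤ blissProfile p a d t := by
  have h1 : 0 < d - a := sub_pos.2 hd
  have h2 : p - 1 ≠ 0 := by linarith
  have ht0 : 0 < t := by linarith
  have h3 : 0 ≤ (d - a) / (p - 1) := div_nonneg h1.le (by linarith)
  have e : t ^ (-(a / (p - 1))) = (t ^ ((d - a) / (p - 1))) ^ (-(a / (d - a))) := by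
    rw [← Real.rpow_mul ht0.le]; congr 1; field_simp
  rw [e, ← Real.mul_rpow two_pos.le (Real.rpow_nonneg ht0.le _)]
  have h4 := Real.one_le_rpow ht h3
  refine Real.rpow_le_rpow_of_nonpos (by positivity) (by linarith) ?_
  rw [neg_nonpos]; positivity

lemma hasDerivAt_blissProfile {p a d t : ℝ} (hp : 1 < p) (hd : a < d) (ht : 0 < t) :
    HasDerivAt (blissProfile p a d) (-(a / (p - 1) * (t ^ ((d - a) / (p - 1) - 1) *
      (1 + t ^ ((d - a) / (p - 1))) ^ (-(d / (d - a)))))) t := by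
  have h1 : d - a ≠ 0 := (sub_pos.2 hd).ne'
  have h2 : p - 1 ≠ 0 := by linarith
  have hY : 0 < 1 + t ^ ((d - a) / (p - 1)) := by positivity
  have h := ((Real.hasDerivAt_rpow_const (p := (d - a) / (p - 1))
    (Or.inl ht.ne')).const_add 1).rpow_const (p := -(a / (d - a))) (Or.inl hY.ne')
  refine h.congr_deriv ?_
  have e : -(a / (d - a)) - 1 = -(d / (d - a)) := by field_simp; ring
  rw [e]
  field_simp

/-- Identifies the energy density of the profile with the integrand of `blissMoment`. -/
lemma rpow_mul_slope_rpow {p a d t : ℝ} (hp : 1 < p) (ha : 0 < a) (hd : a < d) (ht : 0 < t) :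
    t ^ (a + p - 1) * (a / (p - 1) * (t ^ ((d - a) / (p - 1) - 1) *
      (1 + t ^ ((d - a) / (p - 1))) ^ (-(d / (d - a))))) ^ p =
    (a / (p - 1)) ^ p * (t ^ ((d - a) / (p - 1)) * blissDensity p a d t) := by
  have h1 : 0 < d - a := sub_pos.2 hd
  have h2 : 0 < p - 1 := by linarith
  have hY : 0 < 1 + t ^ ((d - a) / (p - 1)) := by positivity
  rw [blissDensity, Real.mul_rpow (by positivity) (by positivity),
    Real.mul_rpow (by positivity) (by positivity), ← Real.rpow_mul ht.le, ← Real.rpow_mul hY.le]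
  have e1 : -(d / (d - a)) * p = -(d * p / (d - a)) := by ring
  have e2 : t ^ (a + p - 1) * t ^ (((d - a) / (p - 1) - 1) * p) =
      t ^ ((d - a) / (p - 1)) * t ^ (d - 1) := by
    rw [← Real.rpow_add ht, ← Real.rpow_add ht]
    congr 1; field_simp; ring
  rw [e1]
  linear_combination ((a / (p - 1)) ^ p *
    (1 + t ^ ((d - a) / (p - 1))) ^ (-(d * p / (d - a)))) * e2

lemma blissMoment_pos {p a d y : ℝ} (hp : 1 < p) (ha : 0 < a) (hd : a < d) (hy : 0 < y) :
    0 < blissMoment p a d y :=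
  intervalIntegral.intervalIntegral_pos_of_pos_on (intervalIntegrable_blissMoment hp ha hd hy.le)
    (fun _ ht => mul_pos (Real.rpow_pos_of_pos ht.1 _) (blissDensity_pos ht.1)) hy

lemma blissEnergy_pos {p a d y : ℝ} (hp : 1 < p) (ha : 0 < a) (hd : a < d) (hy : 0 < y) :
    0 < blissEnergy p a d y := by
  have h2 : 0 < p - 1 := by linarith
  exact mul_pos (by positivity) (blissMoment_pos hp ha hd hy)

lemma blissEnergy_le {p a d y : ℝ} (hp : 1 < p) (ha : 0 < a) (hd : a < d) (hy : 0 < y) :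
    blissEnergy p a d y ≤ totalEnergy p a d := by
  have h2 : 0 < p - 1 := by linarith
  refine mul_le_mul_of_nonneg_left ?_ (by positivity)
  rw [blissMoment, intervalIntegral.integral_of_le hy.le]
  refine setIntegral_mono_set (integrableOn_blissMoment hp ha hd) ?_
    (Ioc_subset_Ioi_self.eventuallyLE)
  filter_upwards [ae_restrict_mem measurableSet_Ioi] with t ht
  exact mul_nonneg (Real.rpow_nonneg (le_of_lt ht) _) (blissDensity_pos ht).le

lemma testFun_hasDerivAt {p a d R r : ℝ} (hp : 1 < p) (hd : a < d) (hR : 0 < R)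
    (hr : 0 < r) : HasDerivAt (testFun p a d R) (-(R ^ (a / p) *
      blissEnergy p a d R ^ (-(1 / p)) * R * (a / (p - 1) * ((R * r) ^ ((d - a) / (p - 1) - 1) *
      (1 + (R * r) ^ ((d - a) / (p - 1))) ^ (-(d / (d - a))))))) r := by
  have h1 : HasDerivAt (fun r => R * r) R r := by simpa using (hasDerivAt_id r).const_mul R
  have h2 := ((hasDerivAt_blissProfile (p := p) hp hd (mul_pos hR hr)).comp r h1).sub_const
    (blissProfile p a d R)
  refine (h2.const_mul (R ^ (a / p) * blissEnergy p a d R ^ (-(1 / p)))).congr_deriv ?_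
  ring

/-- The amplitude R^(a/p) compensates the dilation r ↦ Rr, so the energy before normalization is
that of the profile on (0, R); subtracting a constant does not change the derivative. -/
lemma wNorm_deriv_testFun {p a d R : ℝ} (hp : 1 < p) (ha : 0 < a) (hd : a < d) (hR : 0 < R) :
    wNorm p (a + p - 1) (deriv (testFun p a d R)) = 1 := by
  have hp0 : 0 < p := by linarith
  have hp1 : 0 < p - 1 := by linarith
  have hda : 0 < d - a := sub_pos.2 hd
  have hE := blissEnergy_pos hp ha hd hR
  suffices h : wNorm p (a + p - 1) (deriv (testFun p a d R)) ^ p = 1 by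
    exact ENNReal.rpow_left_injective hp0.ne' (h.trans (ENNReal.one_rpow p).symm)
  set F : ℝ → ℝ := fun t => (a / (p - 1)) ^ p * (t ^ ((d - a) / (p - 1)) * blissDensity p a d t)
    with hF
  set C := R * (blissEnergy p a d R)⁻¹ with hC
  have hpt : ∀ r ∈ Ioo (0 : ℝ) 1, ENNReal.ofReal (r ^ (a + p - 1)) *
      ‖deriv (testFun p a d R) r‖ₑ ^ p = ENNReal.ofReal (C * F (R * r)) := fun r hr => by
    have hr0 := hr.1
    rw [(testFun_hasDerivAt hp hd hR hr.1).deriv, enorm_neg, Real.enorm_of_nonneg (by positivity),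
      ENNReal.ofReal_rpow_of_nonneg (by positivity) hp0.le,
      ← ENNReal.ofReal_mul (by positivity), hF]
    congr 1
    simp only
    rw [← rpow_mul_slope_rpow hp ha hd (mul_pos hR hr.1),
      Real.mul_rpow (by positivity) (by positivity), Real.mul_rpow hR.le hr0.le (z := a + p - 1),
      Real.mul_rpow (by positivity) hR.le, Real.mul_rpow (by positivity) (by positivity),
      ← Real.rpow_mul hE.le, ← Real.rpow_mul hR.le, hC]
    have e1 : -(1 / p) * p = -1 := by field_simp
    have e2 : R * R ^ (a + p - 1) = R ^ (a / p * p) * R ^ p := by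
      rw [← Real.rpow_one_add' hR.le (by linarith), ← Real.rpow_add hR]
      congr 1; field_simp; ring
    rw [e1, Real.rpow_neg_one]
    linear_combination (-(blissEnergy p a d R)⁻¹ * r ^ (a + p - 1) *
      (a / (p - 1) * ((R * r) ^ ((d - a) / (p - 1) - 1) *
      (1 + (R * r) ^ ((d - a) / (p - 1))) ^ (-(d / (d - a))))) ^ p) * e2
  rw [wNorm_rpow hp0, setLIntegral_congr_fun measurableSet_Ioo hpt]
  have hFi : IntervalIntegrable (fun r => C * F (R * r)) volume 0 1 := by
    have h := ((intervalIntegrable_blissMoment hp ha hd hR.le).const_mul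
      ((a / (p - 1)) ^ p)).comp_mul_left (c := R)
    rw [zero_div, div_self hR.ne'] at h
    exact h.const_mul C
  have hI : ∫ r in (0 : ℝ)..1, C * F (R * r) = 1 := by
    rw [intervalIntegral.integral_const_mul, intervalIntegral.integral_comp_mul_left F hR.ne',
      mul_zero, mul_one, hF, intervalIntegral.integral_const_mul]
    change C * (R⁻¹ • blissEnergy p a d R) = 1
    rw [hC, smul_eq_mul]
    field_simp
  rw [← ofReal_integral_eq_lintegral_ofReal
    ((intervalIntegrable_iff_integrableOn_Ioo_of_le zero_le_one).1 hFi),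
    ← integral_Ioc_eq_integral_Ioo, ← intervalIntegral.integral_of_le zero_le_one, hI,
    ENNReal.ofReal_one]
  filter_upwards [ae_restrict_mem measurableSet_Ioo] with r hr
  have h1 : 0 < R * r := mul_pos hR hr.1
  have := blissDensity_pos (p := p) (a := a) (d := d) h1
  simp only [hF, hC, Pi.zero_apply]
  positivity

lemma testFun_preX {p a d α₀ R : ℝ} (hp : 1 < p) (ha : 0 < a) (hd : a < d) (hR : 0 < R)
    (hα₀ : -1 < α₀) : PreX p α₀ (a + p - 1) (testFun p a d R) := by
  have hE := blissEnergy_pos hp ha hd hR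
  refine ⟨fun x y hx hxy _ => ?_, ?_, ?_, ?_, ?_⟩
  · refine ContDiffOn.absolutelyContinuousOnInterval ?_
    rw [uIcc_of_le hxy]
    refine contDiffOn_const.mul (ContDiffOn.sub ?_ contDiffOn_const)
    intro t ht
    have h1 : 0 < R * t := mul_pos hR (hx.trans_le ht.1)
    refine ContDiffAt.contDiffWithinAt ?_
    unfold blissProfile
    exact (contDiffAt_const.add ((contDiffAt_const.mul contDiffAt_id).rpow_const_of_ne
      h1.ne')).rpow_const_of_ne (by positivity)
  · have h := (testFun_hasDerivAt (p := p) hp hd hR one_pos).continuousAt.tendsto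
    have h1 : testFun p a d R 1 = 0 := by simp [testFun]
    rw [h1] at h
    exact h.mono_left nhdsWithin_le_nhds
  · have := isFiniteMeasure_weight hα₀
    have hm : Measurable (testFun p a d R) := by
      unfold testFun blissProfile; fun_prop
    refine MemLp.of_bound hm.aestronglyMeasurable
      (R ^ (a / p) * blissEnergy p a d R ^ (-(1 / p))) ?_
    filter_upwards [(weight_absolutelyContinuous α₀).ae_le (ae_restrict_mem measurableSet_Ioo)]
      with r hr
    have h1 : 0 < R * r := mul_pos hR hr.1
    have h2 := blissProfile_pos (p := p) (a := a) (d := d) h1.le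
    have h3 := blissProfile_pos (p := p) (a := a) (d := d) hR.le
    have h4 := blissProfile_le_one (p := p) ha hd h1.le
    have h5 := blissProfile_le_one (p := p) ha hd hR.le
    rw [testFun, norm_mul, Real.norm_of_nonneg (by positivity), Real.norm_eq_abs]
    refine mul_le_of_le_one_right (by positivity) (abs_le.2 ⟨by linarith, by linarith⟩)
  · exact (measurable_deriv _).aestronglyMeasurable
  · have := wNorm_deriv_testFun hp ha hd hR
    rw [wNorm] at this
    rw [this]; exact ENNReal.one_lt_top

lemma PreX.memX {p α₀ α₁ : ℝ} (hp : 0 < p) {w : ℝ → ℝ} (hw : PreX p α₀ α₁ w) :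
    MemX p α₀ α₁ w (deriv w) := by
  refine ⟨hw.2.2.1, hw.2.2.2, fun ε hε => ⟨w, hw, ?_⟩⟩
  have : ∀ a : ℝ, wNorm p a (fun _ => 0) = 0 := fun a => eLpNorm_zero
  simp only [xNorm, sub_self, this]
  rw [ENNReal.zero_rpow_of_pos hp, add_zero, ENNReal.zero_rpow_of_pos (by positivity)]
  exact hε

/-! ### Lower bound for the functional on a test function. -/

/-- Bernoulli's inequality bounds the loss from subtracting ε, and L^x ≥ e^x ≥ 1 + x gives the gain.
In the gain term G - ε ≥ G/2 suffices. -/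
lemma sub_rpow_mul_rpow_ge {q G ε x L : ℝ} (hq : 1 ≤ q) (hε : 0 < ε) (hG : 2 * ε ≤ G)
    (hx : 0 ≤ x) (hL : Real.exp 1 ≤ L) :
    G ^ q - q * ε * G ^ (q - 1) + x * (2 ^ (-q) * G ^ q) ≤ (G - ε) ^ q * L ^ x := by
  have hG0 : 0 < G := by linarith
  have h1 : G ^ q - q * ε * G ^ (q - 1) ≤ (G - ε) ^ q := by
    have h := one_add_mul_self_le_rpow_one_add (s := -(ε / G))
      (by rw [neg_le_neg_iff, div_le_one hG0]; linarith) hq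
    have e : G - ε = G * (1 + -(ε / G)) := by field_simp; ring
    have h3 : 0 ≤ 1 + -(ε / G) := by
      rw [← sub_eq_add_neg, sub_nonneg, div_le_one hG0]; linarith
    rw [e, Real.mul_rpow hG0.le h3, Real.rpow_sub_one hG0.ne']
    calc G ^ q - q * ε * (G ^ q / G) = G ^ q * (1 + q * -(ε / G)) := by field_simp; ring
      _ ≤ _ := by gcongr
  have h2 : 2 ^ (-q) * G ^ q ≤ (G - ε) ^ q := by
    have e : (2 : ℝ) ^ (-q) * G ^ q = (G / 2) ^ q := by
      rw [Real.div_rpow hG0.le two_pos.le, Real.rpow_neg two_pos.le]; field_simp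
    rw [e]
    exact Real.rpow_le_rpow (by positivity) (by linarith) (by linarith)
  have h3 : 1 + x ≤ L ^ x := by
    calc 1 + x ≤ Real.exp x := by linarith [Real.add_one_le_exp x]
      _ = Real.exp 1 ^ x := by rw [← Real.exp_mul, one_mul]
      _ ≤ L ^ x := Real.rpow_le_rpow (Real.exp_pos _).le hL hx
  have h4 : 0 ≤ (G - ε) ^ q := Real.rpow_nonneg (by linarith) _
  calc _ ≤ (G - ε) ^ q + x * (G - ε) ^ q := by gcongr
    _ = (G - ε) ^ q * (1 + x) := by ring
    _ ≤ _ := by gcongr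

/-- No sign is assumed because the minorant used in `le_supF` may be negative. -/
lemma ofReal_integral_le_lintegral {μ : Measure ℝ} {f : ℝ → ℝ} (hf : Integrable f μ) :
    ENNReal.ofReal (∫ x, f x ∂μ) ≤ ∫⁻ x, ENNReal.ofReal (f x) ∂μ := by
  have h := ofReal_integral_eq_lintegral_ofReal hf.pos_part
    (Eventually.of_forall fun _ => le_max_right _ _)
  calc ENNReal.ofReal (∫ x, f x ∂μ) ≤ ENNReal.ofReal (∫ x, max (f x) 0 ∂μ) :=
        ENNReal.ofReal_le_ofReal (integral_mono hf hf.pos_part fun _ => le_max_left _ _)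
    _ = ∫⁻ x, ENNReal.ofReal (f x) ∂μ := by
        rw [h]; exact lintegral_congr fun x => by simp [ENNReal.ofReal_max]

/-- The density `t ^ (d - 1) g(t) ^ (q - 1)` controlling the loss from truncating the profile. -/
noncomputable def lossDensity (p a d t : ℝ) : ℝ :=
  t ^ (d - 1) * (1 + t ^ ((d - a) / (p - 1))) ^ (-(a / (d - a) * (d * p / a - 1)))

lemma one_le_exponent {p a d : ℝ} (hp : 1 < p) (ha : 0 < a) (hd : a < d) : 1 ≤ d * p / a := by
  rw [le_div_iff₀ ha]; nlinarith

lemma integrableOn_lossDensity {p a d : ℝ} (hp : 1 < p) (ha : 0 < a) (hd : a < d) :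
    IntegrableOn (lossDensity p a d) (Ioi 0) := by
  have hda : 0 < d - a := sub_pos.2 hd
  have hp1 : 0 < p - 1 := by linarith
  have hq := one_le_exponent hp ha hd
  refine integrableOn_rpow_mul_one_add (by linarith)
    (mul_nonneg (by positivity) (by linarith)) ?_
  have e : d - 1 - (d - a) / (p - 1) * (a / (d - a) * (d * p / a - 1)) =
      -1 - (d - a) / (p - 1) := by
    field_simp; ring
  have : 0 < (d - a) / (p - 1) := by positivity
  rw [e]; linarith

lemma intervalIntegrable_rpow_mul_blissDensity {p a d β T : ℝ} (hp : 1 < p) (ha : 0 < a)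
    (hd : a < d) (hβ : 0 ≤ β) (hT : 0 ≤ T) :
    IntervalIntegrable (fun s => s ^ β * blissDensity p a d s) volume 0 T :=
  (intervalIntegrable_blissDensity hp ha hd hT).continuousOn_mul
    (Real.continuous_rpow_const hβ).continuousOn

lemma blissDensity_eq {p a d t : ℝ} (ha : 0 < a) (ht : 0 ≤ t) :
    t ^ (d - 1) * blissProfile p a d t ^ (d * p / a) = blissDensity p a d t := by
  rw [blissProfile, blissDensity, ← Real.rpow_mul (by positivity)]
  congr 2
  field_simp

lemma lossDensity_eq {p a d t : ℝ} (ht : 0 ≤ t) :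
    t ^ (d - 1) * blissProfile p a d t ^ (d * p / a - 1) = lossDensity p a d t := by
  rw [blissProfile, lossDensity, ← Real.rpow_mul (by positivity)]
  ring_nf

/-- Testing the supremum with the truncated profile. -/
lemma le_supF {p a d α₀ τ β R T : ℝ} (hp : 1 < p) (ha : 0 < a) (hd : a < d) (hα₀ : -1 < α₀)
    (hτ : 0 < τ) (hβ : 0 < β) (hT : 0 < T) (hTR : T ≤ R)
    (h1 : 2 * blissProfile p a d R ≤ blissProfile p a d T)
    (h2 : Real.exp (Real.exp 1) ≤ R ^ (a / p) * blissEnergy p a d R ^ (-(1 / p)) *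
      (blissProfile p a d T / 2)) :
    ENNReal.ofReal (blissEnergy p a d R ^ (-(d / a)) * (blissMass p a d T -
      d * p / a * blissProfile p a d R * (∫ s in (0 : ℝ)..T, lossDensity p a d s) +
      R ^ (-β) * 2 ^ (-(d * p / a)) * ∫ s in (0 : ℝ)..T, s ^ β * blissDensity p a d s)) ≤
    supF p α₀ (a + p - 1) (d - 1) τ β := by
  have hR : 0 < R := hT.trans_le hTR
  have hp0 : 0 < p := by linarith
  have hd0 : 0 < d := ha.trans hd
  have hE := blissEnergy_pos hp ha hd hR
  have hX := (testFun_preX hp ha hd hR hα₀).memX hp0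
  have hnorm := wNorm_deriv_testFun hp ha hd hR
  refine le_trans ?_ (le_iSup₂_of_le (testFun p a d R) (deriv (testFun p a d R))
    (le_iSup₂_of_le hX hnorm le_rfl))
  have hcrit : critExp p (a + p - 1) (d - 1) = d * p / a := by
    unfold critExp; congr 1 <;> ring
  rw [hcrit]
  have hq := one_le_exponent hp ha hd
  set q := d * p / a with hq_def
  set ε := blissProfile p a d R with hε_def
  have hε : 0 < ε := blissProfile_pos hR.le
  set Φ : ℝ → ℝ := fun s => blissDensity p a d s - q * ε * lossDensity p a d s +
    R ^ (-β) * 2 ^ (-q) * (s ^ β * blissDensity p a d s) with hΦ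
  have i1 := intervalIntegrable_blissDensity hp ha hd hT.le
  have i2 : IntervalIntegrable (lossDensity p a d) volume 0 T :=
    (intervalIntegrable_iff_integrableOn_Ioc_of_le hT.le).2
      ((integrableOn_lossDensity hp ha hd).mono_set Ioc_subset_Ioi_self)
  have i3 := intervalIntegrable_rpow_mul_blissDensity hp ha hd hβ.le hT.le
  have iΦ : IntervalIntegrable Φ volume 0 T := (i1.sub (i2.const_mul _)).add (i3.const_mul _)
  have hIΦ : ∫ s in (0 : ℝ)..T, Φ s = blissMass p a d T -
      q * ε * (∫ s in (0 : ℝ)..T, lossDensity p a d s) +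
      R ^ (-β) * 2 ^ (-q) * ∫ s in (0 : ℝ)..T, s ^ β * blissDensity p a d s := by
    rw [hΦ, intervalIntegral.integral_add (i1.sub (i2.const_mul _)) (i3.const_mul _),
      intervalIntegral.integral_sub i1 (i2.const_mul _), intervalIntegral.integral_const_mul,
      intervalIntegral.integral_const_mul, blissMass]
  -- What remains of the amplitude to the power q after the substitution s = R r; the Jacobian then
  -- removes the factor R.
  set C := R * blissEnergy p a d R ^ (-(d / a)) with hC
  have hTR' : 0 < T / R := div_pos hT hR
  have hΦi : IntervalIntegrable (fun r => C * Φ (R * r)) volume 0 (T / R) := by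
    have h := iΦ.comp_mul_left (c := R)
    rw [zero_div] at h
    exact h.const_mul C
  have hI : ∫ r in (0 : ℝ)..T / R, C * Φ (R * r) =
      blissEnergy p a d R ^ (-(d / a)) * ∫ s in (0 : ℝ)..T, Φ s := by
    rw [intervalIntegral.integral_const_mul, intervalIntegral.integral_comp_mul_left Φ hR.ne',
      mul_zero, mul_div_cancel₀ _ hR.ne', smul_eq_mul, hC]
    field_simp
  rw [← hIΦ, ← hI, intervalIntegral.integral_of_le hTR'.le, integral_Ioc_eq_integral_Ioo]
  refine (ofReal_integral_le_lintegral
    ((intervalIntegrable_iff_integrableOn_Ioo_of_le hTR'.le).1 hΦi)).trans ?_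
  refine le_trans ?_ (lintegral_mono_set (Ioo_subset_Ioo_right ((div_le_one hR).2 hTR)))
  refine setLIntegral_mono' measurableSet_Ioo fun r hr => ENNReal.ofReal_le_ofReal ?_
  have hr0 := hr.1
  set s := R * r with hs
  have hs0 : 0 < s := mul_pos hR hr0
  have hsT : s ≤ T := by
    have := (lt_div_iff₀ hR).1 hr.2
    rw [hs]; linarith
  set G := blissProfile p a d s with hG
  have hGT : blissProfile p a d T ≤ G := blissProfile_le_of_le hp ha hd hs0.le hsT
  have hεG : 2 * ε ≤ G := h1.trans hGT
  have hGε : 0 ≤ G - ε := by linarith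
  set κ := R ^ (a / p) * blissEnergy p a d R ^ (-(1 / p)) with hκ
  have hκ0 : 0 < κ := by positivity
  have habs : |testFun p a d R r| = κ * (G - ε) := by
    rw [testFun, abs_of_nonneg (mul_nonneg hκ0.le hGε)]
  -- On r < T/R the test function is at least exp(exp 1), so the logarithm is at least e whatever τ
  -- > 0 is.
  have hlog : Real.exp 1 ≤ |Real.log (τ + κ * (G - ε))| := by
    refine le_trans ?_ (le_abs_self _)
    have h3 : Real.exp (Real.exp 1) ≤ τ + κ * (G - ε) := by
      have : κ * (blissProfile p a d T / 2) ≤ κ * (G - ε) :=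
        mul_le_mul_of_nonneg_left (by linarith) hκ0.le
      linarith
    exact (Real.le_log_iff_exp_le ((Real.exp_pos _).trans_le h3)).2 h3
  have hpt := sub_rpow_mul_rpow_ge hq hε hεG (Real.rpow_nonneg hr0.le β) hlog
  rw [habs, Real.mul_rpow hκ0.le hGε]
  have e1 : r ^ (d - 1) * κ ^ q = C * s ^ (d - 1) := by
    rw [hκ, hC, hs, Real.mul_rpow (by positivity) (by positivity), Real.mul_rpow hR.le hr0.le,
      ← Real.rpow_mul hR.le, ← Real.rpow_mul hE.le]
    have e2 : a / p * q = d := by rw [hq_def]; field_simp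
    have e3 : -(1 / p) * q = -(d / a) := by rw [hq_def]; field_simp
    have e4 : R ^ d = R * R ^ (d - 1) := by rw [Real.rpow_sub_one hR.ne']; field_simp
    rw [e2, e3, e4]; ring
  have e5 : r ^ β = R ^ (-β) * s ^ β := by
    rw [hs, Real.mul_rpow hR.le hr0.le, Real.rpow_neg hR.le]
    field_simp
  have e6 : Φ s = s ^ (d - 1) *
      (G ^ q - q * ε * G ^ (q - 1) + r ^ β * (2 ^ (-q) * G ^ q)) := by
    simp only [hΦ]
    rw [← blissDensity_eq ha hs0.le, ← lossDensity_eq hs0.le, e5]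
    ring
  have hC0 : 0 < C := by positivity
  rw [e6]
  calc C * (s ^ (d - 1) * (G ^ q - q * ε * G ^ (q - 1) + r ^ β * (2 ^ (-q) * G ^ q)))
      ≤ C * (s ^ (d - 1) * ((G - ε) ^ q * |Real.log (τ + κ * (G - ε))| ^ r ^ β)) := by gcongr
    _ = C * s ^ (d - 1) * ((G - ε) ^ q * |Real.log (τ + κ * (G - ε))| ^ r ^ β) := by ring
    _ = _ := by rw [← e1]; ring

/-- In the tail 1 + t^b ≥ t^b with b = (d-a)/(p-1) bounds the density by t^(-d/(p-1)-1). -/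
lemma totalMass_sub_le {p a d T : ℝ} (hp : 1 < p) (ha : 0 < a) (hd : a < d) (hT : 0 < T) :
    totalMass p a d - (p - 1) / d * T ^ (-(d / (p - 1))) ≤ blissMass p a d T := by
  have hda : 0 < d - a := sub_pos.2 hd
  have hd0 : 0 < d := ha.trans hd
  have hp1 : 0 < p - 1 := by linarith
  have hi := integrableOn_blissDensity hp ha hd
  have hsub : Ioi T ⊆ Ioi (0 : ℝ) := Ioi_subset_Ioi hT.le
  have h := intervalIntegral.integral_interval_add_Ioi hi (hi.mono_set hsub)
  have hlt : -(d / (p - 1)) - 1 < -1 := by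
    have : 0 < d / (p - 1) := by positivity
    linarith
  have htail : ∫ t in Ioi T, blissDensity p a d t ≤ (p - 1) / d * T ^ (-(d / (p - 1))) := by
    have h1 : ∫ t in Ioi T, blissDensity p a d t ≤ ∫ t in Ioi T, t ^ (-(d / (p - 1)) - 1) := by
      refine setIntegral_mono_on (hi.mono_set hsub) (integrableOn_Ioi_rpow_of_lt hlt hT)
        measurableSet_Ioi fun t ht => ?_
      have ht0 : 0 < t := hT.trans ht
      have h2 := one_add_rpow_neg_le (b := (d - a) / (p - 1)) (f := d * p / (d - a))
        (by
          have : 0 < p := by linarith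
          positivity) ht0
      calc blissDensity p a d t
          ≤ t ^ (d - 1) * t ^ (-((d - a) / (p - 1) * (d * p / (d - a)))) := by
            unfold blissDensity; gcongr
        _ = _ := by
            rw [← Real.rpow_add ht0]; congr 1; field_simp; ring
    refine h1.trans_eq ?_
    rw [integral_Ioi_rpow_of_lt hlt hT, sub_add_cancel]
    field_simp
  rw [totalMass, blissMass]
  linarith

/-! ### Asymptotics as R → ∞ with T = R^η. -/

/-- The lower bound for the mass of the test function in terms of the truncation parameter. -/
noncomputable def massBound (p a d β η R : ℝ) : ℝ :=
  totalMass p a d - (p - 1) / d * R ^ (-(η * d / (p - 1))) -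
    d * p / a * (∫ s in Ioi (0 : ℝ), lossDensity p a d s) * R ^ (-(a / (p - 1))) +
    R ^ (-β) * 2 ^ (-(d * p / a)) * ∫ s in (0 : ℝ)..1, s ^ β * blissDensity p a d s

lemma massBound_le {p a d β η R : ℝ} (hp : 1 < p) (ha : 0 < a) (hd : a < d) (hβ : 0 < β)
    (hη : 0 < η) (hR : 1 ≤ R) : massBound p a d β η R ≤ blissMass p a d (R ^ η) -
      d * p / a * blissProfile p a d R * (∫ s in (0 : ℝ)..R ^ η, lossDensity p a d s) +
      R ^ (-β) * 2 ^ (-(d * p / a)) *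
        ∫ s in (0 : ℝ)..R ^ η, s ^ β * blissDensity p a d s := by
  have hR0 : 0 < R := by linarith
  have hT : 0 < R ^ η := by positivity
  have hd0 : 0 < d := ha.trans hd
  have hp0 : 0 < p := by linarith
  have hda : 0 < d - a := sub_pos.2 hd
  have hT1 : 1 ≤ R ^ η := Real.one_le_rpow hR hη.le
  have h1 := totalMass_sub_le hp ha hd hT
  rw [← Real.rpow_mul hR0.le] at h1
  have e1 : η * -(d / (p - 1)) = -(η * d / (p - 1)) := by ring
  rw [e1] at h1
  have h2 : blissProfile p a d R * (∫ s in (0 : ℝ)..R ^ η, lossDensity p a d s) ≤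
      R ^ (-(a / (p - 1))) * ∫ s in Ioi (0 : ℝ), lossDensity p a d s := by
    have hl : ∀ s, 0 < s → 0 ≤ lossDensity p a d s := fun s hs => by
      unfold lossDensity; positivity
    refine mul_le_mul (blissProfile_le_rpow hp ha hd hR0) ?_ ?_ (by positivity)
    · rw [intervalIntegral.integral_of_le hT.le]
      refine setIntegral_mono_set (integrableOn_lossDensity hp ha hd) ?_
        (Ioc_subset_Ioi_self.eventuallyLE)
      filter_upwards [ae_restrict_mem measurableSet_Ioi] with s hs using hl s hs
    · rw [intervalIntegral.integral_of_le hT.le]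
      exact setIntegral_nonneg measurableSet_Ioc fun s hs => hl s hs.1
  -- Keeping only (0, 1) makes the coefficient of the gain R^(-β) independent of R.
  have h3 : ∫ s in (0 : ℝ)..1, s ^ β * blissDensity p a d s ≤
      ∫ s in (0 : ℝ)..R ^ η, s ^ β * blissDensity p a d s := by
    refine intervalIntegral.integral_mono_interval le_rfl zero_le_one hT1 ?_
      (intervalIntegrable_rpow_mul_blissDensity hp ha hd hβ.le hT.le)
    filter_upwards [ae_restrict_mem measurableSet_Ioc] with s hs
    exact mul_nonneg (Real.rpow_nonneg hs.1.le _) (blissDensity_pos hs.1).le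
  have h4 : d * p / a * (blissProfile p a d R * (∫ s in (0 : ℝ)..R ^ η, lossDensity p a d s)) ≤
      d * p / a * (R ^ (-(a / (p - 1))) * ∫ s in Ioi (0 : ℝ), lossDensity p a d s) := by
    gcongr
  have h5 : R ^ (-β) * 2 ^ (-(d * p / a)) * ∫ s in (0 : ℝ)..1, s ^ β * blissDensity p a d s ≤
      R ^ (-β) * 2 ^ (-(d * p / a)) *
      ∫ s in (0 : ℝ)..R ^ η, s ^ β * blissDensity p a d s := by gcongr
  rw [massBound]
  linarith

lemma tendsto_massBound {p a d β η : ℝ} (hp : 1 < p) (ha : 0 < a) (hd : a < d) (hβ : 0 < β)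
    (hη : 0 < η) : Tendsto (massBound p a d β η) atTop (𝓝 (totalMass p a d)) := by
  have hp1 : 0 < p - 1 := by linarith
  have hd0 : 0 < d := ha.trans hd
  have t1 := (tendsto_rpow_neg_atTop (show 0 < η * d / (p - 1) by positivity)).const_mul
    ((p - 1) / d)
  have t2 := (tendsto_rpow_neg_atTop (show 0 < a / (p - 1) by positivity)).const_mul
    (d * p / a * (∫ s in Ioi (0 : ℝ), lossDensity p a d s))
  have t3 := ((tendsto_rpow_neg_atTop hβ).mul_const (2 ^ (-(d * p / a)))).mul_const
    (∫ s in (0 : ℝ)..1, s ^ β * blissDensity p a d s)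
  have := ((tendsto_const_nhds (x := totalMass p a d)).sub t1).sub t2 |>.add t3
  simpa [funext (fun R => (massBound.eq_1 p a d β η R))] using this

/-- After multiplication by R^β both losses tend to 0, while the gain becomes a positive constant.
-/
lemma eventually_totalMass_lt_massBound {p a d β η : ℝ} (hp : 1 < p) (ha : 0 < a) (hd : a < d)
    (hβ : 0 < β) (h1 : β < η * d / (p - 1)) (h2 : β < a / (p - 1)) :
    ∀ᶠ R in atTop, totalMass p a d < massBound p a d β η R := by
  set c := 2 ^ (-(d * p / a)) * ∫ s in (0 : ℝ)..1, s ^ β * blissDensity p a d s with hc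
  have hc0 : 0 < c := by
    refine mul_pos (by positivity) (intervalIntegral.intervalIntegral_pos_of_pos_on
      (intervalIntegrable_rpow_mul_blissDensity hp ha hd hβ.le zero_le_one)
      (fun s hs => mul_pos (Real.rpow_pos_of_pos hs.1 _) (blissDensity_pos hs.1)) zero_lt_one)
  have t1 := (tendsto_rpow_neg_atTop (show 0 < η * d / (p - 1) - β by linarith)).const_mul
    ((p - 1) / d)
  have t2 := (tendsto_rpow_neg_atTop (show 0 < a / (p - 1) - β by linarith)).const_mul
    (d * p / a * (∫ s in Ioi (0 : ℝ), lossDensity p a d s))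
  have t := t1.add t2
  rw [mul_zero, mul_zero, add_zero] at t
  filter_upwards [t.eventually_lt_const hc0, eventually_gt_atTop 0] with R hR hR0
  have e1 : ∀ x : ℝ, R ^ (-(x - β)) = R ^ (-x) * R ^ β := fun x => by
    rw [← Real.rpow_add hR0]; ring_nf
  rw [e1, e1] at hR
  have hRβ : 0 < R ^ (-β) := by positivity
  have e2 : R ^ β * R ^ (-β) = 1 := by rw [← Real.rpow_add hR0]; simp
  have h := mul_lt_mul_of_pos_right hR hRβ
  have e3 : ((p - 1) / d * (R ^ (-(η * d / (p - 1))) * R ^ β) +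
      d * p / a * (∫ s in Ioi (0 : ℝ), lossDensity p a d s) *
        (R ^ (-(a / (p - 1))) * R ^ β)) * R ^ (-β) =
      (p - 1) / d * R ^ (-(η * d / (p - 1))) +
      d * p / a * (∫ s in Ioi (0 : ℝ), lossDensity p a d s) * R ^ (-(a / (p - 1))) := by
    linear_combination ((p - 1) / d * R ^ (-(η * d / (p - 1))) +
      d * p / a * (∫ s in Ioi (0 : ℝ), lossDensity p a d s) * R ^ (-(a / (p - 1)))) * e2
  rw [e3, hc] at h
  rw [massBound]
  linarith

/-- The profile is comparable to t^(-a/(p-1)) for t ≥ 1, so η < 1 makes its value at R negligible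
against that at R^η. -/
lemma eventually_two_mul_blissProfile_le {p a d η : ℝ} (hp : 1 < p) (ha : 0 < a) (hd : a < d)
    (hη : 0 < η) (hη1 : η < 1) :
    ∀ᶠ R in atTop, 2 * blissProfile p a d R ≤ blissProfile p a d (R ^ η) := by
  have hp1 : 0 < p - 1 := by linarith
  have hx : 0 < a / (p - 1) - η * (a / (p - 1)) := by
    have : 0 < a / (p - 1) := by positivity
    nlinarith
  have t := (tendsto_rpow_neg_atTop hx).const_mul 2
  rw [mul_zero] at t
  filter_upwards [t.eventually_lt_const (show (0 : ℝ) < 2 ^ (-(a / (d - a))) by positivity),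
    eventually_ge_atTop 1] with R hR hR1
  have hR0 : 0 < R := by linarith
  have h1 := blissProfile_le_rpow hp ha hd hR0
  have h2 := le_blissProfile hp ha hd (Real.one_le_rpow hR1 hη.le)
  rw [← Real.rpow_mul hR0.le] at h2
  refine le_trans ?_ h2
  have e : R ^ (-(a / (p - 1))) = R ^ (-(a / (p - 1) - η * (a / (p - 1)))) *
      R ^ (η * -(a / (p - 1))) := by
    rw [← Real.rpow_add hR0]; ring_nf
  calc 2 * blissProfile p a d R ≤ 2 * R ^ (-(a / (p - 1))) := by gcongr
    _ = 2 * R ^ (-(a / (p - 1) - η * (a / (p - 1)))) * R ^ (η * -(a / (p - 1))) := by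
        rw [e]; ring
    _ ≤ _ := by gcongr

/-- At the cut-off the test function has size at least of order R^(a/p - ηa/(p-1)). The condition η
< (p-1)/p makes this exponent positive. -/
lemma eventually_le_amplitude {p a d η : ℝ} (hp : 1 < p) (ha : 0 < a) (hd : a < d)
    (hη : 0 < η) (hη1 : η < (p - 1) / p) (c : ℝ) :
    ∀ᶠ R in atTop, c ≤ R ^ (a / p) * blissEnergy p a d R ^ (-(1 / p)) *
      (blissProfile p a d (R ^ η) / 2) := by
  have hp1 : 0 < p - 1 := by linarith
  have hp0 : 0 < p := by linarith
  have hT := totalEnergy_pos hp ha hd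
  have hx : 0 < a / p - η * (a / (p - 1)) := by
    have h1 : η * (a / (p - 1)) < (p - 1) / p * (a / (p - 1)) := by gcongr
    have h2 : (p - 1) / p * (a / (p - 1)) = a / p := by field_simp
    linarith
  have t := (tendsto_rpow_atTop hx).const_mul_atTop
    (show 0 < totalEnergy p a d ^ (-(1 / p)) * (2 ^ (-(a / (d - a))) / 2) by positivity)
  filter_upwards [t.eventually_ge_atTop c, eventually_ge_atTop 1] with R hR hR1
  have hR0 : 0 < R := by linarith
  have hE := blissEnergy_pos hp ha hd hR0
  refine hR.trans ?_
  have h1 : totalEnergy p a d ^ (-(1 / p)) ≤ blissEnergy p a d R ^ (-(1 / p)) :=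
    Real.rpow_le_rpow_of_nonpos hE (blissEnergy_le hp ha hd hR0)
      (by rw [neg_nonpos]; positivity)
  have h2 := le_blissProfile hp ha hd (Real.one_le_rpow hR1 hη.le)
  rw [← Real.rpow_mul hR0.le] at h2
  have e : R ^ (a / p - η * (a / (p - 1))) = R ^ (a / p) * R ^ (η * -(a / (p - 1))) := by
    rw [← Real.rpow_add hR0]; ring_nf
  calc _ = R ^ (a / p) * totalEnergy p a d ^ (-(1 / p)) *
        ((2 ^ (-(a / (d - a))) * R ^ (η * -(a / (p - 1)))) / 2) := by rw [e]; ring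
    _ ≤ _ := by gcongr

lemma eventually_massBound_le_supF {p a d α₀ τ β η : ℝ} (hp : 1 < p) (ha : 0 < a) (hd : a < d)
    (hα₀ : -1 < α₀) (hτ : 0 < τ) (hβ : 0 < β) (hη : 0 < η) (hη1 : η < (p - 1) / p) :
    ∀ᶠ R in atTop, ENNReal.ofReal (totalEnergy p a d ^ (-(d / a)) * massBound p a d β η R) ≤
      supF p α₀ (a + p - 1) (d - 1) τ β := by
  have hp0 : 0 < p := by linarith
  have hd0 : 0 < d := ha.trans hd
  have hη2 : η < 1 := hη1.trans (by rw [div_lt_one hp0]; linarith)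
  filter_upwards [eventually_ge_atTop 1, eventually_two_mul_blissProfile_le hp ha hd hη hη2,
    eventually_le_amplitude hp ha hd hη hη1 (Real.exp (Real.exp 1)),
    (tendsto_massBound hp ha hd hβ hη).eventually_const_lt (totalMass_pos hp ha hd)]
    with R hR h1 h2 h3
  have hR0 : 0 < R := by linarith
  have hE := blissEnergy_pos hp ha hd hR0
  have hTR : R ^ η ≤ R := by
    simpa using Real.rpow_le_rpow_of_exponent_le hR hη2.le
  refine le_trans (ENNReal.ofReal_le_ofReal ?_)
    (le_supF hp ha hd hα₀ hτ hβ (by positivity) hTR h1 h2)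
  -- Replacing the energy on (0, R) by the larger total energy lowers the bound only because
  -- `massBound` is eventually positive.
  refine mul_le_mul ?_ (massBound_le hp ha hd hβ hη hR) h3.le (by positivity)
  exact Real.rpow_le_rpow_of_nonpos hE (blissEnergy_le hp ha hd hR0)
    (by rw [neg_nonpos]; positivity)

lemma blissConst_le_supF {p a d α₀ τ β : ℝ} (hp : 1 < p) (ha : 0 < a) (hd : a < d)
    (hα₀ : -1 < α₀) (hτ : 0 < τ) (hβ : 0 < β) :
    ENNReal.ofReal (blissConst p a d) ≤ supF p α₀ (a + p - 1) (d - 1) τ β := by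
  have hp1 : 0 < p - 1 := by linarith
  have hp0 : 0 < p := by linarith
  have hη : 0 < (p - 1) / p / 2 := by positivity
  have t := ENNReal.tendsto_ofReal ((tendsto_massBound hp ha hd hβ hη).const_mul
    (totalEnergy p a d ^ (-(d / a))))
  rw [mul_comm] at t
  exact le_of_tendsto t (eventually_massBound_le_supF hp ha hd hα₀ hτ hβ hη
    (half_lt_self (by positivity)))

lemma blissConst_lt_supF {p a d α₀ τ β : ℝ} (hp : 1 < p) (ha : 0 < a) (hd : a < d)
    (hα₀ : -1 < α₀) (hτ : 0 < τ) (hβ : 0 < β) (h1 : β < d / p) (h2 : β < a / (p - 1)) :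
    ENNReal.ofReal (blissConst p a d) < supF p α₀ (a + p - 1) (d - 1) τ β := by
  have hp1 : 0 < p - 1 := by linarith
  have hp0 : 0 < p := by linarith
  have hd0 : 0 < d := ha.trans hd
  -- η must beat the cut-off loss, β < ηd/(p-1), and keep the test function large, η < (p-1)/p; both
  -- are possible exactly when β < d/p.
  obtain ⟨η, hη, hη1⟩ : ∃ η, β * (p - 1) / d < η ∧ η < (p - 1) / p := exists_between (by
    rw [div_lt_div_iff₀ hd0 hp0]
    rw [lt_div_iff₀ hp0] at h1
    nlinarith)
  have hη0 : 0 < η := lt_trans (by positivity) hη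
  have hβη : β < η * d / (p - 1) := by
    rw [lt_div_iff₀ hp1]; rwa [div_lt_iff₀ hd0] at hη
  obtain ⟨R, hR1, hR2⟩ := ((eventually_totalMass_lt_massBound hp ha hd hβ hβη h2).and
    (eventually_massBound_le_supF hp ha hd hα₀ hτ hβ hη0 hη1)).exists
  refine lt_of_lt_of_le ?_ hR2
  have hT : 0 < totalEnergy p a d ^ (-(d / a)) := Real.rpow_pos_of_pos (totalEnergy_pos hp ha hd) _
  have hM := totalMass_pos hp ha hd
  rw [ENNReal.ofReal_lt_ofReal_iff (mul_pos hT (hM.trans hR1)), blissConst, mul_comm]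
  gcongr

end LogHardySobolev

theorem theorem1p3 (p α₀ α₁ θ : ℝ) (hp : 1 < p) (hα₁ : 0 < α₁ - p + 1)
    (hα₀ : α₁ - p ≤ α₀) (hθ : α₁ - p < θ) (τ : ℝ) (hτ : 0 < τ) :
    (∀ β : ℝ, 0 < β →
      LogHardySobolev.sobolevSup p α₀ α₁ θ ≤ LogHardySobolev.supF p α₀ α₁ θ τ β) ∧
    (∀ β : ℝ, 0 < β → β < min ((θ + 1) / p) ((α₁ - p + 1) / (p - 1)) →
      LogHardySobolev.sobolevSup p α₀ α₁ θ < LogHardySobolev.supF p α₀ α₁ θ τ β) ∧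
    Tendsto (fun β : ℝ => LogHardySobolev.supF p α₀ α₁ θ τ β) atTop
      (𝓝 (LogHardySobolev.sobolevSup p α₀ α₁ θ)) := by
  have hup := LogHardySobolev.sobolevSup_le_blissConst (α₀ := α₀) hp hα₁ hθ
  have hd : α₁ - p + 1 < θ + 1 := by linarith
  have hα : -1 < α₀ := by linarith
  have e1 : α₁ - p + 1 + p - 1 = α₁ := by ring
  have e2 : θ + 1 - 1 = θ := by ring
  have hle : ∀ β : ℝ, 0 < β →
      LogHardySobolev.sobolevSup p α₀ α₁ θ ≤ LogHardySobolev.supF p α₀ α₁ θ τ β := by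
    intro β hβ
    have h := LogHardySobolev.blissConst_le_supF hp hα₁ hd hα hτ hβ
    rw [e1, e2] at h
    exact hup.trans h
  refine ⟨hle, fun β hβ hβ' => ?_, LogHardySobolev.tendsto_supF hp hα₁ hθ hτ hle⟩
  have h := LogHardySobolev.blissConst_lt_supF hp hα₁ hd hα hτ hβ
    (hβ'.trans_le (min_le_left _ _)) (hβ'.trans_le (min_le_right _ _))
  rw [e1, e2] at h
  exact hup.trans_lt h
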